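/- **Conventions.** $\lambda$-terms (and the elementary terms below) are taken up to $\alpha$-equivalence. Simple types are $\sigma::=o\mid\sigma\to\sigma$. EAL formulas are $A::=o\mid A\multimap A\mid\,!A$. A *general EAL-type* is $\Theta::=\,!^{e}o\mid\,!^{e}(\Theta\multimap\Theta)$, where $e=n_1+\dots+n_k$ ($k\ge0$) is a formal sum of variables ranging over $\mathbb N$, and $!^{n}!^{e}\Theta$ is identified with $!^{n+e}\Theta$. A *linear constraint* is $\sum\pm n_i=0$ or $\sum n_i\ge1$. An integer solution $X$ assigns a natural number to each variable; $X(\Theta)$ and $X(B)$ are the instantiations. A *slice* is a set of critical points, i.e. of pairs (constraint $A^j$, list of free variable occurrences); an occurrence belongs to a slice $sl$ if it is in one of the lists of $sl$, a constraint belongs to $sl$ if it is the first component of one of its pairs. Constraints are referred to as rows of the system, so that a slice always refers to the current form of its constraints. $\mathrm{FVO}(M)$ is the list of free variable occurrences of $M$. **The algorithm.** The input is a simple type derivation (in natural deduction) of $M:\sigma$; all variables introduced are fresh. * $\mathcal P(o)=\,!^po$, $\ \mathcal P(\sigma\to\tau)=\,!^p(\mathcal P(\sigma)\multimap\mathcal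 P(\tau))$. * $\mathcal U(\Theta_1,\dots,\Theta_h)$, for types of the same shape, equates corresponding exponents of consecutive types: $e_i-e_{i+1}=0$ at every position. * $\mathcal C(\Theta)=\emptyset$; for $k\ge2$, $\mathcal C(!^e\Theta_1,\dots,\Theta_k)$ is $\{e\ge1\}\cup\mathcal U(!^e\Theta_1,\dots,\Theta_k)$. * *Boxing.* $\mathbb B(M,B,\Gamma,cpts,A)$ is $\langle B,\Gamma,A\rangle$ if $M$ is a variable. Otherwise, for each slice $sl\in cpts$ successively, take a fresh $c$, replace $\Gamma$ by $!^c\Gamma$, replace $\Theta$ by $!^c\Theta$ for every occurrence $x:\Theta$ of the base not in $sl$, and replace every constraint $A^j\in sl$, of the form $s=0$, by $s-c=0$; finally, put $!^b$, $b$ fresh, in front of $\Gamma$ and of every type of the base. * *Product union.* $S\Cup T=S\cup T\cup\{s\cup t: s\in S,t\in T\}$. * $\mathcal S(M:\sigma)=\langle\Theta,B,A,cpts\rangle$ is defined by recursion, where the base $B$ is a multiset with one element for each free variable occurrence: * $\mathcal S(x:\sigma)=\langle\Theta,\{x:\Theta\},\emptyset,\emptyset\rangle$ with $\Theta=\mathcal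 P(\sigma)$. * $\lambda x.M:\sigma\to\tau$. Let $\mathcal S(M:\tau)=\langle\Gamma_1,B_1,A_1,cpts\rangle$ and $\mathbb B(M,B_1,\Gamma_1,cpts,A_1)=\langle B',\Gamma,A\rangle$. If $x\in\mathrm{FV}(M)$ and $B'=B\cup\{x:\Theta_1,\dots,x:\Theta_h\}$, with $x$ not in $B$, the result is $\langle\Theta_1\multimap\Gamma,B,A\cup\mathcal C(\Theta_1,\dots,\Theta_h),cpts'\rangle$, where $cpts'$ is $cpts$ without the slices to which an occurrence of $x$ belongs. If $x\notin\mathrm{FV}(M)$ and $M$ is an application, let $\Gamma=\,!^{e}\Delta$ with $e$ its whole outermost exponent; the result is $\langle\mathcal P(\sigma)\multimap\,!^n\Delta,\,B',\,A\cup\{e-n=0\},\,cpts\cup\{\{(e-n=0,\mathrm{FVO}(M))\}\}\rangle$, $n$ fresh. Otherwise the result is $\langle\mathcal P(\sigma)\multimap\Gamma,B',A,cpts\rangle$. * $(M\,N):\tau$ with $M:\sigma\to\tau$, $N:\sigma$. Let $\mathcal S(M)=\langle!^{e}(\Theta_1\multimap\Gamma),B_1,A_1,cpts_1\rangle$, $\mathcal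 S(N)=\langle\Theta_2,B_2,A_2,cpts_2\rangle$, $\mathbb B(N,B_2,\Theta_2,cpts_2,A_2)=\langle B_3,\Theta_3,A_3\rangle$, and let $A_4=\mathcal U(\Theta_3,\Theta_1)$ if $N$ is an application, $A_4=\mathcal U(\Theta_1,\Theta_3)$ otherwise. The result is $\langle\Gamma,B_1\cup B_3,A_1\cup A_3\cup A_4\cup\{e=0\},cpts_1'\Cup cpts_2'\rangle$, where $cpts_1'$ is $cpts_1$, together with the slice $\{(e=0,\mathrm{FVO}(M))\}$ if $M$ is an application, and $cpts_2'$ is $cpts_2$, together with the slice $\{(A_4^1,\mathrm{FVO}(N))\}$ if $N$ is an application; $A_4^1$ is the constraint between the outermost exponents. * *Top level.* $\mathscr S(M:\sigma)=\langle\Theta,B,A\rangle$: apply $\mathcal S$, then $\mathbb B$ to its result; $\Theta$ is the type so obtained; for each free variable $x$ of $M$, with types $\Theta_1,\dots,\Theta_k$ in the base so obtained, $B$ contains $x:\Theta_1$; $A$ consists of the constraints so obtained and of all the $\mathcal C(\Theta_1,\dots,\Theta_k)$. **Elementary terms and NEAL.** Elementary terms are $P::=x\mid\lambda x.P\mid(P\,P)\mid\,!(P)[P_1/x_1,\dots,P_n/x_n]\mid[P]_{Q/x,y}$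 ($n\ge 0$; the $x_i$, resp. $x,y$, are bound in $P$). $P^*$ is the $\lambda$-term obtained by performing the substitutions: $(!(P)[P_i/x_i])^*=P^*\{P_i^*/x_i\}$, $([P]_{Q/x,y})^*=P^*\{Q^*/x,Q^*/y\}$, homomorphic otherwise. *EAL-terms* are the legal elementary terms, i.e. those in which the parts $M,N$ of each application, the $P_i$ of each box, and $Q$ and $\lambda x.\lambda y.P$ for each contraction $[P]_{Q/x,y}$ have pairwise disjoint sets of free variables, and $\mathrm{FV}(P)=\{x_1,\dots,x_n\}$ for each box $!(P)[P_i/x_i]$. The judgement $\Gamma\vdash_{\mathsf{NEAL}}P:A$ ($\Gamma$ a base giving at most one formula to each variable) is generated by the following rules, where bases separated by commas have disjoint domains: $\Gamma,x:A\vdash x:A$; from $\Gamma,x:A\vdash M:B$ infer $\Gamma\vdash\lambda x.M:A\multimap B$; from $\Gamma\vdash M:A\multimap B$ and $\Delta\vdash N:A$ infer $\Gamma,\Delta\vdash(M\,N):B$; from $\Gamma\vdash M:\,!A$ and $\Delta,x:!A,y:!A\vdash N:B$ infer $\Gamma,\Delta\vdash[N]_{M/x,y}:B$; from $\Delta_i\vdash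 M_i:\,!A_i$ ($1\le i\le n$) and $x_1:A_1,\dots,x_n:A_n\vdash N:B$ infer $\Gamma,\Delta_1,\dots,\Delta_n\vdash\,!(N)[M_1/x_1,\dots,M_n/x_n]:\,!B$. The length $L$ counts abstractions and applications. An EAL-term $P$ is a *candidate* if (1) no subterm of $P$ has one of the forms $[N]_{!(M)[\dots]/x,y}$, $\;!(M)[\dots,{!(N)[\dots]}/x_i,\dots]$, $\;([M]_{Q/x,y}\ N)$, $\;(M\ [N]_{Q/x,y})$, $\;!(M)[\dots,[N]_{Q/y,z}/x_i,\dots]$, $\;[M]_{[N]_{Q/y,z}/x,y'}$, or $\lambda x.[M]_{N/y,z}$ with $x\notin\mathrm{FV}(N)$ (that is, $P$ is normal for all the reduction rules other than $\beta$); (2) $P$ is simple: $Q^*$ is a variable for every subterm $[R]_{Q/x,y}$ of $P$, and $L(P)=L(P^*)$; (3) $x,y\in\mathrm{FV}(R)$ for every subterm $[R]_{Q/x,y}$ of $P$; (4) $R$ is not a variable for every subterm $!(R)[\dots]$ of $P$. **Theorem (Soundness).** Let $M$ be a simply typed $\lambda$-term of type $\sigma$ and let $\mathscr S(M:\sigma)=\langle\Theta,B,A\rangle$.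 For every integer solution $X$ of $A$ there is a candidate EAL-term $P$ such that $P^*=M$ and $X(B)\vdash_{\mathsf{NEAL}}P:X(\Theta)$. -/

import Mathlib

namespace EAL

/-! ### Pure lambda terms, up to alpha-equivalence (de Bruijn indices) -/

/-- Pure lambda terms. An index that points above all enclosing binders is a free variable. -/
inductive Lam : Type
  | var (i : ℕ)
  | lam (M : Lam)
  | app (M N : Lam)

namespace Lam

def rename : (ℕ → ℕ) → Lam → Lam
  | ρ, var i => var (ρ i)
  | ρ, lam M => lam (rename (fun i => Nat.casesOn i 0 (fun j => ρ j + 1)) M)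
  | ρ, app M N => app (rename ρ M) (rename ρ N)

/-- Simultaneous capture-avoiding substitution of `s i` for the free variable `i`. -/
def subst : (ℕ → Lam) → Lam → Lam
  | s, var i => s i
  | s, lam M => lam (subst (fun i => Nat.casesOn i (var 0) (fun j => rename Nat.succ (s j))) M)
  | s, app M N => app (subst s M) (subst s N)

/-- The length: the number of abstractions and applications. -/
def length : Lam → ℕ
  | var _ => 0
  | lam M => 1 + length M
  | app M N => 1 + length M + length N

def isVar : Lam → Bool
  | var _ => true
  | _ => false

def isApp : Lam → Bool
  | app _ _ => true
  | _ => false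

end Lam

/-! ### Simple types and simple type derivations -/

/-- Simple types over the base type `o`. -/
inductive STy : Type
  | o
  | arr (σ τ : STy)

/-- Natural deduction derivations of `Γ ⊢ M : σ` in the simple type discipline, that is,
syntax trees of `M` decorated with simple types. -/
inductive SDer : List STy → Lam → STy → Type
  | var {Γ : List STy} {σ : STy} (i : ℕ) (h : Γ[i]? = some σ) : SDer Γ (Lam.var i) σ
  | lam {Γ : List STy} {σ τ : STy} {M : Lam} (d : SDer (σ :: Γ) M τ) :
      SDer Γ (Lam.lam M) (STy.arr σ τ)
  | app {Γ : List STy} {σ τ : STy} {M N : Lam}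
      (d : SDer Γ M (STy.arr σ τ)) (e : SDer Γ N σ) : SDer Γ (Lam.app M N) τ

/-! ### General EAL-types and linear constraints -/

/-- A formal sum `n₁ + ⋯ + n_k` of integer variables (the variables are named by numbers). -/
abbrev Expo := List ℕ

/-- General EAL-types: `base e` is `!^e o` and `arr e Θ Δ` is `!^e (Θ ⊸ Δ)`. -/
inductive GTy : Type
  | base (e : Expo)
  | arr (e : Expo) (Θ Δ : GTy)

namespace GTy

/-- The exponent of the outermost modality. -/
def expo : GTy → Expo
  | base e => e
  | arr e _ _ => e

/-- `!^n Θ`, where `!^n !^e` is identified with `!^(n + e)`. -/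
def bang (n : ℕ) : GTy → GTy
  | base e => base (n :: e)
  | arr e Θ Δ => arr (n :: e) Θ Δ

/-- Replace the exponent of the outermost modality by the single variable `n`. -/
def setExpo (n : ℕ) : GTy → GTy
  | base _ => base [n]
  | arr _ Θ Δ => arr [n] Θ Δ

end GTy

/-- Linear constraints: `eqZero e f` is `∑ e - ∑ f = 0` and `geOne e` is `∑ e ≥ 1`. -/
inductive Constr : Type
  | eqZero (e f : Expo)
  | geOne (e : Expo)

/-- `A^j - c` for an equality constraint `A^j`; inequalities are never modified. -/
def Constr.sub (c : ℕ) : Constr → Constr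
  | .eqZero e f => .eqZero e (c :: f)
  | .geOne e => .geOne e

/-- A row of the constraint matrix, with a name by which slices refer to it. -/
structure Row where
  name : ℕ
  constr : Constr

/-- An element `x : Θ` of a base, together with the occurrence of `x` it stands for. -/
structure Entry where
  var : ℕ
  occ : ℕ
  ty : GTy

/-- A slice: a list of critical points (name of a constraint, list of free variable
occurrences). -/
abbrev Slice := List (ℕ × List ℕ)

/-- The variable occurrence `y` belongs to one of the lists of the slice. -/
def Slice.hasOcc (sl : Slice) (y : ℕ) : Bool := sl.any fun p => p.2.contains y

/-- The constraint named `j` belongs to the slice. -/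
def Slice.hasRow (sl : Slice) (j : ℕ) : Bool := sl.any fun p => p.1 == j

/-- The quadruple `⟨Θ, B, A, cpts⟩`. The base is a multiset with exactly one element for each
free variable occurrence of the term. -/
structure Result where
  ty : GTy
  base : List Entry
  rows : List Row
  cpts : List Slice

/-! ### The type synthesis algorithm -/

/-- Computations that may draw fresh names and that may fail. -/
abbrev Fresh := StateT ℕ Option

/-- A fresh name. -/
def fresh : Fresh ℕ := fun n => some (n, n + 1)

/-- Give fresh names to constraints. -/
def nameRows : List Constr → Fresh (List Row)
  | [] => pure []
  | c :: cs => do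
    let j ← fresh
    let rs ← nameRows cs
    pure (⟨j, c⟩ :: rs)

/-- Binary unification; undefined on types of different shapes. The first constraint is the
one between the outermost exponents. -/
def unify : GTy → GTy → Option (List Constr)
  | .base e, .base f => some [.eqZero e f]
  | .arr e Θ Δ, .arr f Θ' Δ' => do
    let A ← unify Θ Θ'
    let A' ← unify Δ Δ'
    some (.eqZero e f :: (A ++ A'))
  | _, _ => none

/-- Unification of a list of types: consecutive ones are made equal. -/
def unifyAll : List GTy → Option (List Constr)
  | Θ :: Θ' :: Θs => do
    let A ← unify Θ Θ'
    let A' ← unifyAll (Θ' :: Θs)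
    some (A ++ A')
  | _ => some []

/-- Contraction of a list of types. -/
def contract : List GTy → Option (List Constr)
  | Θ :: Θ' :: Θs => do
    let A ← unifyAll (Θ :: Θ' :: Θs)
    some (.geOne Θ.expo :: A)
  | _ => some []

/-- Type processing: a fresh exponent everywhere. -/
def process : STy → Fresh GTy
  | .o => do
    let p ← fresh
    pure (.base [p])
  | .arr σ τ => do
    let p ← fresh
    let Θ ← process σ
    let Δ ← process τ
    pure (.arr [p] Θ Δ)

/-- The inner boxing procedure: for each slice, `c` boxes that close at its critical points. -/
def boxSlices : List Slice → List Entry → GTy → List Row → Fresh (List Entry × GTy × List Row)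
  | [], B, Γ, A => pure (B, Γ, A)
  | sl :: cpts, B, Γ, A => do
    let c ← fresh
    boxSlices cpts
      (B.map fun e => if sl.hasOcc e.occ then e else { e with ty := e.ty.bang c })
      (Γ.bang c)
      (A.map fun r => if sl.hasRow r.name then { r with constr := r.constr.sub c } else r)

/-- The boxing function applied to the synthesis `r` of the term `M`: variables are not boxed;
any other term gets the boxes through its critical points and then `b` boxes around it. The
critical points are kept (they refer to the constraints by name). -/
def boxing (M : Lam) (r : Result) : Fresh Result :=
  if M.isVar then pure r
  else do
    let (B, Γ, A) ← boxSlices r.cpts r.base r.ty r.rows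
    let b ← fresh
    pure ⟨Γ.bang b, B.map fun e => { e with ty := e.ty.bang b }, A, r.cpts⟩

/-- Product union of sets of slices. -/
def prodUnion : List Slice → List Slice → List Slice
  | [], cpts => cpts
  | cpts, [] => cpts
  | sl :: cpts₁, cpts₂ => (sl :: cpts₂.map fun sl' => sl ++ sl') ++ prodUnion cpts₁ cpts₂

/-- The free variable occurrences of a term, read off from its base. -/
def fvo (B : List Entry) : List ℕ := B.map Entry.occ

/-- Variable case. -/
def synthVar (i : ℕ) (σ : STy) : Fresh Result := do
  let Θ ← process σ
  let y ← fresh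
  pure ⟨Θ, [⟨i, y, Θ⟩], [], []⟩

/-- Abstraction cases, for `λ x. M` with `x : σ`, given the synthesis `r` of `M`. The bound
variable is the index `0`; the first case is the one where it occurs in `M`. -/
def synthLam (σ : STy) (M : Lam) (r : Result) : Fresh Result := do
  let ⟨Γ, B', A, cpts⟩ ← boxing M r
  let Bx := B'.filter fun e => e.var == 0
  let B := (B'.filter fun e => e.var != 0).map fun e => { e with var := e.var - 1 }
  match Bx with
  | e :: es =>
    let A₃ ← contract ((e :: es).map Entry.ty)
    let R₃ ← nameRows A₃
    -- the slices in which the bound variable occurs are discarded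
    pure ⟨.arr [] e.ty Γ, B, A ++ R₃,
      cpts.filter fun sl => !((e :: es).any fun e' => sl.hasOcc e'.occ)⟩
  | [] =>
    let Θ ← process σ
    if M.isApp then
      let n ← fresh
      let j ← fresh
      pure ⟨.arr [] Θ (Γ.setExpo n), B, A ++ [⟨j, .eqZero Γ.expo [n]⟩],
        cpts ++ [[(j, fvo B)]]⟩
    else
      pure ⟨.arr [] Θ Γ, B, A, cpts⟩

/-- The four application cases, for `(M N)`, given the syntheses `r₁` of `M` and `r₂` of `N`.
There is a critical point at the root of `M` (resp. `N`) if `M` (resp. `N`) is itself an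
application. -/
def synthApp (M N : Lam) (r₁ r₂ : Result) : Fresh Result :=
  match r₁.ty with
  | .base _ => failure
  | .arr ns Θ₁ Γ => do
    let ⟨Θ₃, B₃, A₃, cpts₂⟩ ← boxing N r₂
    let A₄ ← if N.isApp then unify Θ₃ Θ₁ else unify Θ₁ Θ₃
    let R₄ ← nameRows A₄
    let j ← fresh
    let cptsM := if M.isApp then r₁.cpts ++ [[(j, fvo r₁.base)]] else r₁.cpts
    let cptsN := if N.isApp then
        cpts₂ ++ (R₄.take 1).map fun r => [(r.name, fvo B₃)]
      else cpts₂
    pure ⟨Γ, r₁.base ++ B₃, r₁.rows ++ A₃ ++ R₄ ++ [⟨j, .eqZero ns []⟩], prodUnion cptsM cptsN⟩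

/-- The type synthesis function, by recursion on the simple type derivation. -/
def synth : {Γ : List STy} → {M : Lam} → {σ : STy} → SDer Γ M σ → Fresh Result
  | _, _, _, .var (σ := σ) i _ => synthVar i σ
  | _, _, _, .lam (σ := σ) (M := M) d => do
    let r ← synth d
    synthLam σ M r
  | _, _, _, .app (M := M) (N := N) d e => do
    let r₁ ← synth d
    let r₂ ← synth e
    synthApp M N r₁ r₂

/-- Contraction of the common variables of a base: for each variable `x` of the list, keep the
first element `x : Θ` of the base and contract all of them. -/
def contractBase (B : List Entry) : List ℕ → Option (List (ℕ × GTy) × List Constr)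
  | [] => some ([], [])
  | x :: xs => do
    let Θs := (B.filter fun e => e.var == x).map Entry.ty
    let A ← contract Θs
    let (B', A') ← contractBase B xs
    some ((Θs.take 1).map (fun Θ => (x, Θ)) ++ B', A ++ A')

/-- The type synthesis algorithm: the triple `⟨Θ, B, A⟩` computed for a simply typed term. -/
def typeSynthesis {Γ : List STy} {M : Lam} {σ : STy} (d : SDer Γ M σ) :
    Option (GTy × List (ℕ × GTy) × List Constr) := do
  let (r, _) ← (synth d >>= boxing M).run 0
  let (B, A) ← contractBase r.base (r.base.map Entry.var).dedup
  some (r.ty, B, r.rows.map Row.constr ++ A)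

/-! ### EAL formulas, instantiations -/

/-- EAL formulas. -/
inductive Ty : Type
  | o
  | lolli (A B : Ty)
  | bang (A : Ty)

/-- The value of a formal sum. -/
def Expo.eval (X : ℕ → ℕ) (e : Expo) : ℕ := (e.map X).sum

/-- `X(Θ)`. -/
def GTy.inst (X : ℕ → ℕ) : GTy → Ty
  | .base e => Ty.bang^[Expo.eval X e] Ty.o
  | .arr e Θ Δ => Ty.bang^[Expo.eval X e] (Ty.lolli (Θ.inst X) (Δ.inst X))

def Constr.Sat (X : ℕ → ℕ) : Constr → Prop
  | .eqZero e f => (Expo.eval X e : ℤ) - (Expo.eval X f : ℤ) = 0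
  | .geOne e => 1 ≤ Expo.eval X e

/-- `X` is a solution of the set of constraints `A`; the variables range over the natural
numbers. -/
def IsSolution (X : ℕ → ℕ) (A : List Constr) : Prop := ∀ c ∈ A, c.Sat X

/-- Linear bases: each variable has at most one formula. -/
abbrev Ctx := ℕ → Option Ty

/-- `Γ, x : A` for the variable `x` of index `0`. -/
def Ctx.cons (A : Ty) (Γ : Ctx) : Ctx
  | 0 => some A
  | i + 1 => Γ i

/-- `Ξ` is the union of the bases `Δ i`, and these have pairwise disjoint domains. -/
def Ctx.IsUnion {ι : Type} (Ξ : Ctx) (Δ : ι → Ctx) : Prop :=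
  (∀ i j x, Δ i x ≠ none → Δ j x ≠ none → i = j) ∧
    ∀ x A, Ξ x = some A ↔ ∃ i, Δ i x = some A

/-- `X(B)`. -/
def instBase (X : ℕ → ℕ) (B : List (ℕ × GTy)) : Ctx := fun x => (B.lookup x).map (GTy.inst X)

/-! ### Elementary affine terms -/

/-- Elementary affine terms. `prom n M N` is `!(M)[N₀/x₀, …, N_{n-1}/x_{n-1}]`, where `x_i` is
the index `i` in `M`; `contr M N` is the contraction `[M]_{N/x,y}`, where `x` and `y` are the
indices `0` and `1` in `M`. -/
inductive EATerm : Type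
  | var (i : ℕ)
  | lam (M : EATerm)
  | app (M N : EATerm)
  | prom (n : ℕ) (M : EATerm) (N : Fin n → EATerm)
  | contr (M N : EATerm)

namespace EATerm

/-- Free variables. -/
def FV : EATerm → Set ℕ
  | var i => {i}
  | lam M => {i | i + 1 ∈ FV M}
  | app M N => FV M ∪ FV N
  | prom n M N => (⋃ k, FV (N k)) ∪ {i | i + n ∈ FV M}
  | contr M N => {i | i + 2 ∈ FV M} ∪ FV N

/-- The underlying lambda term `P*`. -/
def star : EATerm → Lam
  | var i => .var i
  | lam M => .lam (star M)
  | app M N => .app (star M) (star N)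
  | prom n M N =>
      (star M).subst fun i => if h : i < n then star (N ⟨i, h⟩) else .var (i - n)
  | contr M N => (star M).subst fun i => if i < 2 then star N else .var (i - 2)

/-- The length `L(P)`. -/
def length : EATerm → ℕ
  | var _ => 0
  | lam M => 1 + length M
  | app M N => 1 + length M + length N
  | prom _ M N => length M + ∑ k, length (N k)
  | contr M N => length M + length N

/-- Legal terms. -/
def Legal : EATerm → Prop
  | var _ => True
  | lam M => Legal M
  | app M N => Legal M ∧ Legal N ∧ Disjoint M.FV N.FV
  | prom n M N => Legal M ∧ (∀ k, Legal (N k)) ∧ M.FV = {i | i < n} ∧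
      ∀ k l, k ≠ l → Disjoint (N k).FV (N l).FV
  | contr M N => Legal M ∧ Legal N ∧ Disjoint {i | i + 2 ∈ M.FV} N.FV

/-- `Subterm Q P`: `Q` is a subterm of `P`. -/
inductive Subterm : EATerm → EATerm → Prop
  | refl (P : EATerm) : Subterm P P
  | lam {Q M : EATerm} : Subterm Q M → Subterm Q (lam M)
  | appL {Q M N : EATerm} : Subterm Q M → Subterm Q (app M N)
  | appR {Q M N : EATerm} : Subterm Q N → Subterm Q (app M N)
  | promBody {Q M : EATerm} {n : ℕ} {N : Fin n → EATerm} :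
      Subterm Q M → Subterm Q (prom n M N)
  | promArg {Q M : EATerm} {n : ℕ} {N : Fin n → EATerm} (k : Fin n) :
      Subterm Q (N k) → Subterm Q (prom n M N)
  | contrBody {Q M N : EATerm} : Subterm Q M → Subterm Q (contr M N)
  | contrArg {Q M N : EATerm} : Subterm Q N → Subterm Q (contr M N)

/-- The redexes (left-hand sides) of the reduction rules other than beta. -/
inductive Redex : EATerm → Prop
  | dup (N M : EATerm) (n : ℕ) (P : Fin n → EATerm) : Redex (contr N (prom n M P))
  | bangBang (n : ℕ) (M : EATerm) (N : Fin n → EATerm) (k : Fin n)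
      (m : ℕ) (R : EATerm) (P : Fin m → EATerm) (h : N k = prom m R P) : Redex (prom n M N)
  | appContrL (M M₁ N : EATerm) : Redex (app (contr M M₁) N)
  | appContrR (M N N₁ : EATerm) : Redex (app M (contr N N₁))
  | bangContr (n : ℕ) (M : EATerm) (N : Fin n → EATerm) (k : Fin n)
      (R Q : EATerm) (h : N k = contr R Q) : Redex (prom n M N)
  | contrContr (M N P : EATerm) : Redex (contr M (contr N P))
  | lamContr (M N : EATerm) (h : 0 ∉ N.FV) : Redex (lam (contr M N))

/-- No subterm is a redex of one of the reduction rules other than beta. -/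
def Normal (P : EATerm) : Prop := ∀ Q, Subterm Q P → ¬ Redex Q

/-- Simple terms. -/
def Simple (P : EATerm) : Prop :=
  (∀ M N, Subterm (contr M N) P → ∃ i, N.star = .var i) ∧ P.length = P.star.length

/-- Candidate EAL-terms (EAL-terms are legal). -/
structure Candidate (P : EATerm) : Prop where
  legal : P.Legal
  normal : P.Normal
  simple : P.Simple
  contr_mem : ∀ R Q, Subterm (contr R Q) P → 0 ∈ R.FV ∧ 1 ∈ R.FV
  prom_ne_var : ∀ n R Q, Subterm (prom n R Q) P → ∀ i, R ≠ var i

end EATerm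

/-! ### The term assignment system -/

/-- `NEAL Γ P A` is the judgement `Γ ⊢ P : A` of natural deduction for elementary affine
logic. -/
inductive NEAL : Ctx → EATerm → Ty → Prop
  | ax {Γ : Ctx} {i : ℕ} {A : Ty} (h : Γ i = some A) : NEAL Γ (.var i) A
  | contr {Ξ Γ Δ : Ctx} {M N : EATerm} {A B : Ty} (h : Ξ.IsUnion ![Γ, Δ])
      (hM : NEAL Γ M (.bang A))
      (hN : NEAL (Ctx.cons (.bang A) (Ctx.cons (.bang A) Δ)) N B) : NEAL Ξ (.contr N M) B
  | lam {Γ : Ctx} {M : EATerm} {A B : Ty} (h : NEAL (Ctx.cons A Γ) M B) :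
      NEAL Γ (.lam M) (.lolli A B)
  | app {Ξ Γ Δ : Ctx} {M N : EATerm} {A B : Ty} (h : Ξ.IsUnion ![Γ, Δ])
      (hM : NEAL Γ M (.lolli A B)) (hN : NEAL Δ N A) : NEAL Ξ (.app M N) B
  | prom {Ξ Γ : Ctx} {n : ℕ} {Δ : Fin n → Ctx} {N : EATerm} {M : Fin n → EATerm}
      {A : Fin n → Ty} {B : Ty} (h : Ξ.IsUnion (fun k : Option (Fin n) => k.elim Γ Δ))
      (hM : ∀ k, NEAL (Δ k) (M k) (.bang (A k)))
      (hN : NEAL (fun i => if h : i < n then some (A ⟨i, h⟩) else none) N B) :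
      NEAL Ξ (.prom n N M) (.bang B)

end EAL

/-!
Name the occurrences of the variables of `M` apart; this turns `M` into a linear skeleton, in
which contractions and boxes no longer have to be written. A solution `X` then says, for every
subterm, how many boxes surround it, and each occurrence of a variable carries the number of boxes
around the place where it is declared. In such a levelled typing a box may be closed only at a
subterm all of whose free occurrences are declared outside of it.

From the synthesis to levelled typings, the difficulty is that the boxing function, applied to a
term that encloses a given subterm, still modifies the constraints and types of that subterm,
through the slices of its critical points. The invariant is therefore quantified over a multiset
`w` of slices, which stand for the boxes added later: each constraint may be off by the number of
elements of `w` to which it belongs. A product union is made for this to pass to the two parts of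
an application, since every slice of the union restricts to at most one slice of either part.

From levelled typings to elementary terms, cut the skeleton along its outermost box. What lies
inside of it is typed with one level less and becomes the content of a promotion; the maximal
subterms at which the box is closed have type `!A` at level `0` and become the arguments, and they
are never promotions themselves. Finally the occurrences of the same variable are identified one
after the other by contractions on a variable, at an abstraction or, for the free variables, at
the root.
-/

namespace EAL

/-! ### Substitution in pure lambda terms -/

namespace Lam

/-- The extension of a renaming under a binder. -/
def upRename (ρ : ℕ → ℕ) : ℕ → ℕ := fun i => Nat.casesOn i 0 fun j => ρ j + 1

/-- The extension of a substitution under a binder. -/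
def upSubst (s : ℕ → Lam) : ℕ → Lam :=
  fun i => Nat.casesOn i (var 0) fun j => (s j).rename Nat.succ

theorem rename_lam (ρ : ℕ → ℕ) (M : Lam) : rename ρ (lam M) = lam (rename (upRename ρ) M) := rfl

theorem subst_lam (s : ℕ → Lam) (M : Lam) : subst s (lam M) = lam (subst (upSubst s) M) := rfl

theorem rename_rename (M : Lam) (ρ ρ' : ℕ → ℕ) :
    (M.rename ρ).rename ρ' = M.rename (ρ' ∘ ρ) := by
  induction M generalizing ρ ρ' with
  | var i => rfl
  | lam M ih =>
    simp only [rename_lam, ih]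
    congr 2 with i
    cases i <;> rfl
  | app M N ihM ihN => simp only [rename, ihM, ihN]

theorem subst_rename (M : Lam) (ρ : ℕ → ℕ) (s : ℕ → Lam) :
    (M.rename ρ).subst s = M.subst (s ∘ ρ) := by
  induction M generalizing ρ s with
  | var i => rfl
  | lam M ih =>
    simp only [rename_lam, subst_lam, ih]
    congr 2
    funext i
    cases i <;> rfl
  | app M N ihM ihN => simp only [rename, subst, ihM, ihN]

theorem rename_subst (M : Lam) (ρ : ℕ → ℕ) (s : ℕ → Lam) :
    (M.subst s).rename ρ = M.subst fun i => (s i).rename ρ := by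
  induction M generalizing ρ s with
  | var i => rfl
  | lam M ih =>
    simp only [rename_lam, subst_lam, ih]
    congr 2
    funext i
    cases i with
    | zero => rfl
    | succ i =>
      change ((s i).rename Nat.succ).rename (upRename ρ) = ((s i).rename ρ).rename Nat.succ
      rw [rename_rename, rename_rename]
      rfl
  | app M N ihM ihN => simp only [rename, subst, ihM, ihN]

theorem subst_upSubst_rename_succ (M : Lam) (s : ℕ → Lam) :
    (M.rename Nat.succ).subst (upSubst s) = (M.subst s).rename Nat.succ := by
  rw [subst_rename, rename_subst]
  rfl

theorem rename_eq_subst (M : Lam) (ρ : ℕ → ℕ) : M.rename ρ = M.subst (var ∘ ρ) := by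
  induction M generalizing ρ with
  | var i => rfl
  | lam M ih =>
    simp only [rename_lam, subst_lam, ih]
    congr 2
    funext i
    cases i <;> rfl
  | app M N ihM ihN => simp only [rename, subst, ihM, ihN]

theorem length_rename (M : Lam) (ρ : ℕ → ℕ) : (M.rename ρ).length = M.length := by
  induction M generalizing ρ with
  | var i => rfl
  | lam M ih => simp only [rename_lam, length, ih]
  | app M N ihM ihN => simp only [rename, length, ihM, ihN]

end Lam

/-! ### Skeletons -/

/-- Lambda terms in which every variable occurrence has a name of its own; an abstraction binds
a set of occurrences. -/
inductive Skel : Type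
  | leaf (y : ℕ)
  | lam (S : Finset ℕ) (D : Skel)
  | app (D E : Skel)

namespace Skel

/-- The names of the free occurrences. -/
def fv : Skel → Finset ℕ
  | leaf y => {y}
  | lam S D => D.fv \ S
  | app D E => D.fv ∪ E.fv

/-- The names of all occurrences, free or bound. -/
def leaves : Skel → Finset ℕ
  | leaf y => {y}
  | lam _ D => D.leaves
  | app D E => D.leaves ∪ E.leaves

/-- The name of the leftmost occurrence. -/
def name : Skel → ℕ
  | leaf y => y
  | lam _ D => D.name
  | app D _ => D.name

/-- Different occurrences have different names, and abstractions bind free occurrences. -/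
def Linear : Skel → Prop
  | leaf _ => True
  | lam S D => S ⊆ D.fv ∧ D.Linear
  | app D E => Disjoint D.leaves E.leaves ∧ D.Linear ∧ E.Linear

/-- The number of abstractions and applications. -/
def length : Skel → ℕ
  | leaf _ => 0
  | lam _ D => 1 + D.length
  | app D E => 1 + D.length + E.length

/-- The lambda term obtained by replacing every free occurrence `y` by `s y`. -/
def toLam (s : ℕ → Lam) : Skel → Lam
  | leaf y => s y
  | lam S D => .lam (D.toLam (S.piecewise (fun _ => .var 0) fun y => (s y).rename Nat.succ))
  | app D E => .app (D.toLam s) (E.toLam s)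

theorem fv_subset_leaves (D : Skel) : D.fv ⊆ D.leaves := by
  induction D with
  | leaf y => exact subset_rfl
  | lam S D ih => exact Finset.sdiff_subset.trans ih
  | app D E ihD ihE => exact Finset.union_subset_union ihD ihE

theorem name_mem_leaves (D : Skel) : D.name ∈ D.leaves := by
  induction D with
  | leaf y => exact Finset.mem_singleton_self y
  | lam _ _ ih => exact ih
  | app _ _ ihD _ => exact Finset.mem_union_left _ ihD

theorem toLam_congr (D : Skel) {s t : ℕ → Lam} (h : ∀ y ∈ D.fv, s y = t y) :
    D.toLam s = D.toLam t := by
  induction D generalizing s t with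
  | leaf y => exact h y (Finset.mem_singleton_self y)
  | lam S D ih =>
    refine congrArg Lam.lam (ih fun y hy => ?_)
    by_cases hS : y ∈ S
    · simp [hS]
    · simp [hS, h y (Finset.mem_sdiff.2 ⟨hy, hS⟩)]
  | app D E ihD ihE =>
    exact congrArg₂ Lam.app (ihD fun y hy => h y (Finset.mem_union_left _ hy))
      (ihE fun y hy => h y (Finset.mem_union_right _ hy))

theorem toLam_subst (D : Skel) (s t : ℕ → Lam) :
    (D.toLam s).subst t = D.toLam fun y => (s y).subst t := by
  induction D generalizing s t with
  | leaf y => rfl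
  | lam S D ih =>
    simp only [toLam, Lam.subst_lam, ih]
    congr 2 with y
    by_cases hS : y ∈ S
    · simp [hS, Lam.subst, Lam.upSubst]
    · simp [hS, Lam.subst_upSubst_rename_succ]
  | app D E ihD ihE => simp only [toLam, Lam.subst, ihD, ihE]

theorem toLam_rename (D : Skel) (s : ℕ → Lam) (ρ : ℕ → ℕ) :
    (D.toLam s).rename ρ = D.toLam fun y => (s y).rename ρ := by
  simp only [Lam.rename_eq_subst, toLam_subst]

theorem length_toLam (D : Skel) {s : ℕ → Lam} (hs : ∀ y, (s y).length = 0) :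
    (D.toLam s).length = D.length := by
  induction D generalizing s with
  | leaf y => exact hs y
  | lam S D ih =>
    refine congrArg (1 + ·) (ih fun y => ?_)
    by_cases hS : y ∈ S <;> simp [hS, Lam.length, Lam.length_rename, hs]
  | app D E ihD ihE => simp only [toLam, Lam.length, length, ihD hs, ihE hs]

end Skel

/-! ### Levelled typing of skeletons -/

/-- The declaration of a variable occurrence: its type, together with the number of boxes around
the place where it is declared. -/
structure Decl where
  level : ℕ
  ty : Ty

/-- A declaration for every variable occurrence. -/
abbrev Env := ℕ → Decl

namespace Skel

/-- `D.AcrossBoxes J a A`: seen from inside `a` nested boxes `D` has type `A`, because `J` holds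
of `D` inside some other number of nested boxes. Boxes may be opened and closed at the root of `D`,
except that none is opened at a variable. -/
def AcrossBoxes (D : Skel) (J : ℕ → Ty → Prop) (a : ℕ) (A : Ty) : Prop :=
  ∃ b B, J b B ∧ Ty.bang^[b] B = Ty.bang^[a] A ∧ (D.length = 0 → b ≤ a)

/-- `D.Typed a Γ A`: inside `a` nested boxes the skeleton `D` has type `A`. A box can be closed only
at a subterm all of whose free occurrences are declared outside of it, and an abstraction that
binds several occurrences has to contract them. -/
def Typed : Skel → ℕ → Env → Ty → Prop
  | leaf y, a, Γ, A => (Γ y).level ≤ a ∧ (Γ y).ty = Ty.bang^[a - (Γ y).level] A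
  | lam S D, a, Γ, T => (∀ y ∈ D.fv \ S, (Γ y).level ≤ a) ∧
      ∃ A B, T = .lolli A B ∧ (2 ≤ S.card → ∃ A', A = .bang A') ∧
        D.AcrossBoxes (fun b => D.Typed b (S.piecewise (fun _ => ⟨a, A⟩) Γ)) a B
  | app D E, a, Γ, A => (∀ y ∈ D.fv ∪ E.fv, (Γ y).level ≤ a) ∧
      ∃ B, D.AcrossBoxes (fun b => D.Typed b Γ) a (.lolli B A) ∧
        E.AcrossBoxes (fun b => E.Typed b Γ) a B

/-- `D` has type `A` inside `a` nested boxes, where boxes may be opened and closed at its root. -/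
def BoxTyped (D : Skel) (a : ℕ) (Γ : Env) (A : Ty) : Prop :=
  D.AcrossBoxes (fun b => D.Typed b Γ) a A

theorem AcrossBoxes.imp {D : Skel} {J J' : ℕ → Ty → Prop} {a : ℕ} {A : Ty}
    (h : D.AcrossBoxes J a A) (hJ : ∀ b B, (D.length = 0 → b ≤ a) → J b B → J' b B) :
    D.AcrossBoxes J' a A :=
  let ⟨b, B, hB, heq, hle⟩ := h
  ⟨b, B, hJ b B hle hB, heq, hle⟩

theorem Typed.boxTyped {D : Skel} {a : ℕ} {Γ : Env} {A : Ty} (h : D.Typed a Γ A) :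
    D.BoxTyped a Γ A :=
  ⟨a, A, h, rfl, fun _ => le_rfl⟩

theorem BoxTyped.of_bang {D : Skel} {a k : ℕ} {Γ : Env} {A : Ty}
    (h : D.BoxTyped a Γ (Ty.bang^[k] A)) : D.BoxTyped (a + k) Γ A := by
  obtain ⟨b, B, hB, heq, hle⟩ := h
  exact ⟨b, B, hB, by rw [heq, Function.iterate_add_apply],
    fun hD => (hle hD).trans (Nat.le_add_right a k)⟩

theorem Typed.level_le {D : Skel} {a : ℕ} {Γ : Env} {A : Ty} (h : D.Typed a Γ A) :
    ∀ y ∈ D.fv, (Γ y).level ≤ a := by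
  cases D with
  | leaf y => simpa only [fv, Finset.mem_singleton, forall_eq] using h.1
  | lam S D => exact h.1
  | app D E => exact h.1

theorem Typed.congr {D : Skel} {a : ℕ} {Γ Γ' : Env} {A : Ty} (h : D.Typed a Γ A)
    (hΓ : ∀ y ∈ D.fv, Γ y = Γ' y) : D.Typed a Γ' A := by
  induction D generalizing a A Γ Γ' with
  | leaf y =>
    have hy := hΓ y (Finset.mem_singleton_self y)
    simpa only [Typed, hy] using h
  | lam S D ih =>
    obtain ⟨hle, B, C, rfl, hS, hD⟩ := h
    refine ⟨fun y hy => hΓ y hy ▸ hle y hy, B, C, rfl, hS,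
      hD.imp fun _ _ _ hT => ih hT fun y hy => ?_⟩
    by_cases hyS : y ∈ S
    · simp [hyS]
    · simp [hyS, hΓ y (Finset.mem_sdiff.2 ⟨hy, hyS⟩)]
  | app D E ihD ihE =>
    obtain ⟨hle, B, hD, hE⟩ := h
    exact ⟨fun y hy => hΓ y hy ▸ hle y hy, B,
      hD.imp fun _ _ _ hT => ihD hT fun y hy => hΓ y (Finset.mem_union_left _ hy),
      hE.imp fun _ _ _ hT => ihE hT fun y hy => hΓ y (Finset.mem_union_right _ hy)⟩

end Skel

/-! ### Cutting a skeleton along the outermost box -/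

/-- A subterm of type `!ty` that lies outside of the outermost box. -/
structure Piece where
  skel : Skel
  ty : Ty

/-- `Cut Γ D D' Ds`: the skeleton `D'` is what remains of `D` inside the outermost box. The maximal
subterms at which that box is closed are the pieces `Ds`; each of them is replaced by a leaf. -/
inductive Cut : Env → Skel → Skel → List Piece → Prop
  | piece {Γ : Env} {D : Skel} {A : Ty} (h : D.Typed 0 Γ (.bang A)) :
      Cut Γ D (.leaf D.name) [⟨D, A⟩]
  | inner {Γ : Env} {y : ℕ} (h : 1 ≤ (Γ y).level) : Cut Γ (.leaf y) (.leaf y) []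
  | lam {Γ : Env} {S : Finset ℕ} {a : ℕ} {A : Ty} {D D' : Skel} {Ds : List Piece}
      (h : Cut (S.piecewise (fun _ => ⟨a + 1, A⟩) Γ) D D' Ds) : Cut Γ (.lam S D) (.lam S D') Ds
  | app {Γ : Env} {D D' E E' : Skel} {Ds Es : List Piece} (hD : Cut Γ D D' Ds)
      (hE : Cut Γ E E' Es) : Cut Γ (.app D E) (.app D' E') (Ds ++ Es)

namespace Cut

variable {Γ : Env} {D D' : Skel} {Ds : List Piece}

theorem leaves_subset (h : Cut Γ D D' Ds) : D'.leaves ⊆ D.leaves := by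
  induction h with
  | piece _ => exact Finset.singleton_subset_iff.2 (Skel.name_mem_leaves _)
  | inner _ => exact subset_rfl
  | lam _ ih => exact ih
  | app _ _ ihD ihE => exact Finset.union_subset_union ihD ihE

theorem piece_leaves_subset (h : Cut Γ D D' Ds) : ∀ p ∈ Ds, p.skel.leaves ⊆ D.leaves := by
  induction h with
  | piece _ => simp
  | inner _ => simp
  | lam _ ih => exact ih
  | app _ _ ihD ihE =>
    exact List.forall_mem_append.2 ⟨fun p hp => (ihD p hp).trans Finset.subset_union_left,
      fun p hp => (ihE p hp).trans Finset.subset_union_right⟩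

theorem length_eq (h : Cut Γ D D' Ds) :
    D.length = D'.length + (Ds.map fun p => p.skel.length).sum := by
  induction h with
  | piece _ => simp [Skel.length]
  | inner _ => simp [Skel.length]
  | lam _ ih => simp only [Skel.length, ih, add_assoc]
  | app _ _ ihD ihE =>
    simp only [Skel.length, ihD, ihE, List.map_append, List.sum_append]
    omega

theorem piece_linear (h : Cut Γ D D' Ds) (hD : D.Linear) : ∀ p ∈ Ds, p.skel.Linear := by
  induction h with
  | piece _ => simpa using hD
  | inner _ => simp
  | lam _ ih => exact ih hD.2
  | app _ _ ihD ihE => exact List.forall_mem_append.2 ⟨ihD hD.2.1, ihE hD.2.2⟩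

theorem piece_pairwise_disjoint (h : Cut Γ D D' Ds) (hD : D.Linear) :
    Ds.Pairwise fun p q => Disjoint p.skel.leaves q.skel.leaves := by
  induction h with
  | piece _ => exact List.pairwise_singleton _ _
  | inner _ => exact .nil
  | lam _ ih => exact ih hD.2
  | app hcD hcE ihD ihE =>
    exact List.pairwise_append.2 ⟨ihD hD.2.1, ihE hD.2.2, fun p hp q hq =>
      hD.1.mono (hcD.piece_leaves_subset p hp) (hcE.piece_leaves_subset q hq)⟩

/-- A bound occurrence is declared inside the outermost box, hence it is not free in a piece. -/
theorem notMem_of_typed_zero {S : Finset ℕ} {a : ℕ} {A B : Ty} {E : Skel}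
    (h : E.Typed 0 (S.piecewise (fun _ => ⟨a + 1, A⟩) Γ) B) : ∀ y ∈ E.fv, y ∉ S :=
  fun y hy hyS => by simpa [hyS] using h.level_le y hy

theorem piece_typed (h : Cut Γ D D' Ds) : ∀ p ∈ Ds, p.skel.Typed 0 Γ (.bang p.ty) := by
  induction h with
  | piece h => simpa using h
  | inner _ => simp
  | lam _ ih =>
    exact fun p hp => (ih p hp).congr fun y hy => by
      simp [notMem_of_typed_zero (ih p hp) y hy]
  | app _ _ ihD ihE => exact List.forall_mem_append.2 ⟨ihD, ihE⟩

theorem piece_level (h : Cut Γ D D' Ds) : ∀ p ∈ Ds, ∀ y ∈ p.skel.fv, (Γ y).level = 0 :=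
  fun p hp y hy => Nat.le_zero.1 ((h.piece_typed p hp).level_le y hy)

theorem piece_fv_subset (h : Cut Γ D D' Ds) : ∀ p ∈ Ds, p.skel.fv ⊆ D.fv := by
  induction h with
  | piece _ => simp
  | inner _ => simp
  | lam h ih =>
    exact fun p hp y hy => Finset.mem_sdiff.2
      ⟨ih p hp hy, notMem_of_typed_zero (h.piece_typed p hp) y hy⟩
  | app _ _ ihD ihE =>
    exact List.forall_mem_append.2 ⟨fun p hp => (ihD p hp).trans Finset.subset_union_left,
      fun p hp => (ihE p hp).trans Finset.subset_union_right⟩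

theorem exists_piece (h : Cut Γ D D' Ds) :
    ∀ y ∈ D.fv, (Γ y).level = 0 → ∃ p ∈ Ds, y ∈ p.skel.fv := by
  induction h with
  | piece _ => exact fun y hy _ => ⟨_, List.mem_singleton_self _, hy⟩
  | inner h =>
    intro y hy h0
    rw [Finset.mem_singleton.1 hy] at h0
    omega
  | lam _ ih =>
    intro y hy h0
    obtain ⟨hyD, hyS⟩ := Finset.mem_sdiff.1 hy
    exact ih y hyD (by simpa [hyS] using h0)
  | app _ _ ihD ihE =>
    intro y hy h0
    rcases Finset.mem_union.1 hy with hyD | hyE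
    · obtain ⟨p, hp, hyp⟩ := ihD y hyD h0
      exact ⟨p, List.mem_append_left _ hp, hyp⟩
    · obtain ⟨p, hp, hyp⟩ := ihE y hyE h0
      exact ⟨p, List.mem_append_right _ hp, hyp⟩

theorem piece_name_ne (h : Cut Γ D D' Ds) (hD : D.Linear) :
    ∀ p ∈ Ds, ∀ y ∈ D.fv, 1 ≤ (Γ y).level → p.skel.name ≠ y := by
  induction h with
  | piece h =>
    intro p _ y hy hlevel
    have := h.level_le y hy
    omega
  | inner _ => simp
  | lam _ ih =>
    intro p hp y hy hlevel
    obtain ⟨hyD, hyS⟩ := Finset.mem_sdiff.1 hy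
    exact ih hD.2 p hp y hyD (by simpa [hyS] using hlevel)
  | app hcD hcE ihD ihE =>
    refine List.forall_mem_append.2 ⟨fun p hp y hy hlevel => ?_, fun p hp y hy hlevel => ?_⟩ <;>
      rcases Finset.mem_union.1 hy with hyD | hyE
    · exact ihD hD.2.1 p hp y hyD hlevel
    · exact Finset.disjoint_iff_ne.1 hD.1 _ (hcD.piece_leaves_subset p hp p.skel.name_mem_leaves) _
        (Skel.fv_subset_leaves _ hyE)
    · exact (Finset.disjoint_iff_ne.1 hD.1 _ (Skel.fv_subset_leaves _ hyD) _
        (hcE.piece_leaves_subset p hp p.skel.name_mem_leaves)).symm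
    · exact ihE hD.2.2 p hp y hyE hlevel

theorem piece_name_notMem {S : Finset ℕ} {a : ℕ} {A : Ty}
    (h : Cut (S.piecewise (fun _ => ⟨a + 1, A⟩) Γ) D D' Ds) (hD : D.Linear) (hS : S ⊆ D.fv) :
    ∀ p ∈ Ds, p.skel.name ∉ S :=
  fun p hp hpS => h.piece_name_ne hD p hp _ (hS hpS) (by simp [hpS]) rfl

theorem mem_fv_iff (h : Cut Γ D D' Ds) (hD : D.Linear) (y : ℕ) :
    y ∈ D'.fv ↔ (y ∈ D.fv ∧ 1 ≤ (Γ y).level) ∨ ∃ p ∈ Ds, p.skel.name = y := by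
  induction h with
  | @piece Γ D _ h =>
    have hlevel : ¬(y ∈ D.fv ∧ 1 ≤ (Γ y).level) := fun hy => by
      have := h.level_le y hy.1
      omega
    simp [hlevel, Skel.fv, eq_comm]
  | inner h =>
    simp only [Skel.fv, Finset.mem_singleton, List.not_mem_nil, false_and, exists_false, or_false]
    exact ⟨fun hy => ⟨hy, hy ▸ h⟩, fun hy => hy.1⟩
  | @lam _ S _ _ _ _ _ h ih =>
    have hname := h.piece_name_notMem hD.2 hD.1
    simp only [Skel.fv, Finset.mem_sdiff, ih hD.2]
    by_cases hyS : y ∈ S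
    · simpa [hyS] using fun p hp (hpy : p.skel.name = y) => hname p hp (hpy ▸ hyS)
    · simp [hyS]
  | app _ _ ihD ihE =>
    simp only [Skel.fv, Finset.mem_union, ihD hD.2.1, ihE hD.2.2, List.mem_append, or_and_right,
      exists_or]
    exact or_or_or_comm

theorem linear (h : Cut Γ D D' Ds) (hD : D.Linear) : D'.Linear := by
  induction h with
  | piece _ => trivial
  | inner _ => trivial
  | lam h ih =>
    exact ⟨fun y hy => (h.mem_fv_iff hD.2 y).2 (.inl ⟨hD.1 hy, by simp [hy]⟩), ih hD.2⟩
  | app hcD hcE ihD ihE =>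
    exact ⟨hD.1.mono hcD.leaves_subset hcE.leaves_subset, ihD hD.2.1, ihE hD.2.2⟩

theorem toLam_eq (h : Cut Γ D D' Ds) (hD : D.Linear) {s s' : ℕ → Lam}
    (hs : ∀ y ∈ D.fv, 1 ≤ (Γ y).level → s' y = s y)
    (hs' : ∀ p ∈ Ds, s' p.skel.name = p.skel.toLam s) : D'.toLam s' = D.toLam s := by
  induction h generalizing s s' with
  | piece _ => exact hs' _ (List.mem_singleton_self _)
  | inner h => exact hs _ (Finset.mem_singleton_self _) h
  | @lam _ S _ _ _ _ _ h ih =>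
    refine congrArg Lam.lam (ih hD.2 (fun y hy hlevel => ?_) fun p hp => ?_)
    · by_cases hyS : y ∈ S
      · simp [hyS]
      · simp only [hyS, not_false_eq_true, Finset.piecewise_eq_of_notMem] at hlevel ⊢
        rw [hs y (Finset.mem_sdiff.2 ⟨hy, hyS⟩) hlevel]
    · rw [Finset.piecewise_eq_of_notMem _ _ _ (h.piece_name_notMem hD.2 hD.1 p hp), hs' p hp,
        Skel.toLam_rename]
      refine Skel.toLam_congr _ fun y hy => ?_
      rw [Finset.piecewise_eq_of_notMem _ _ _ (notMem_of_typed_zero (h.piece_typed p hp) y hy)]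
  | app _ _ ihD ihE =>
    exact congrArg₂ Lam.app
      (ihD hD.2.1 (fun y hy => hs y (Finset.mem_union_left _ hy))
        fun p hp => hs' p (List.mem_append_left _ hp))
      (ihE hD.2.2 (fun y hy => hs y (Finset.mem_union_right _ hy))
        fun p hp => hs' p (List.mem_append_right _ hp))

end Cut

/-- `Γ'` declares the free occurrences of what remains of `D` inside the outermost box, as seen from
inside that box. -/
structure CutEnv (Γ Γ' : Env) (D : Skel) (Ds : List Piece) : Prop where
  inner : ∀ y ∈ D.fv, 1 ≤ (Γ y).level → Γ' y = ⟨(Γ y).level - 1, (Γ y).ty⟩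
  piece : ∀ p ∈ Ds, Γ' p.skel.name = ⟨0, p.ty⟩

theorem CutEnv.level_le {a : ℕ} {Γ Γ' : Env} {D D' : Skel} {Ds : List Piece}
    (hΓ : CutEnv Γ Γ' D Ds) (h : Cut Γ D D' Ds) (hD : D.Linear)
    (hle : ∀ y ∈ D.fv, (Γ y).level ≤ a + 1) : ∀ y ∈ D'.fv, (Γ' y).level ≤ a := by
  intro y hy
  rcases (h.mem_fv_iff hD y).1 hy with ⟨hyD, hlevel⟩ | ⟨p, hp, rfl⟩
  · rw [hΓ.inner y hyD hlevel]
    exact Nat.sub_le_of_le_add (hle y hyD)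
  · rw [hΓ.piece p hp]
    exact Nat.zero_le a

theorem CutEnv.piecewise {a : ℕ} {A : Ty} {S : Finset ℕ} {Γ Γ' : Env} {D D' : Skel}
    {Ds : List Piece} (hΓ : CutEnv Γ Γ' (.lam S D) Ds)
    (h : Cut (S.piecewise (fun _ => ⟨a + 1, A⟩) Γ) D D' Ds) (hD : D.Linear) (hS : S ⊆ D.fv) :
    CutEnv (S.piecewise (fun _ => ⟨a + 1, A⟩) Γ) (S.piecewise (fun _ => ⟨a, A⟩) Γ') D Ds where
  inner y hy hlevel := by
    by_cases hyS : y ∈ S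
    · simp [hyS]
    · simp only [hyS, not_false_eq_true, Finset.piecewise_eq_of_notMem] at hlevel ⊢
      exact hΓ.inner y (Finset.mem_sdiff.2 ⟨hy, hyS⟩) hlevel
  piece p hp := by
    rw [Finset.piecewise_eq_of_notMem _ _ _ (h.piece_name_notMem hD hS p hp)]
    exact hΓ.piece p hp

namespace Skel

theorem BoxTyped.exists_cut {a : ℕ} {Γ : Env} {D : Skel} {A : Ty} (h : D.BoxTyped (a + 1) Γ A)
    (ih : ∀ b B, D.Typed (b + 1) Γ B → ∃ D' Ds, Cut Γ D D' Ds ∧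
      (D'.length = 0 → D.length = 0) ∧ ∀ Γ', CutEnv Γ Γ' D Ds → D'.Typed b Γ' B) :
    ∃ D' Ds, Cut Γ D D' Ds ∧ ∀ Γ', CutEnv Γ Γ' D Ds → D'.BoxTyped a Γ' A := by
  obtain ⟨b, B, hB, heq, hle⟩ := h
  rw [Function.iterate_succ_apply'] at heq
  cases b with
  | zero =>
    obtain rfl : B = _ := heq
    refine ⟨_, _, .piece hB, fun Γ' hΓ' => Typed.boxTyped ?_⟩
    simp [Typed, hΓ'.piece _ (List.mem_singleton_self _)]
  | succ b =>
    obtain ⟨D', Ds, hcut, hlength, hD'⟩ := ih b B hB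
    rw [Function.iterate_succ_apply', Ty.bang.injEq] at heq
    exact ⟨D', Ds, hcut, fun Γ' hΓ' => ⟨b, B, hD' Γ' hΓ', heq,
      fun h0 => Nat.succ_le_succ_iff.1 (hle (hlength h0))⟩⟩

theorem Typed.exists_cut {a : ℕ} {Γ : Env} {D : Skel} {A : Ty} (h : D.Typed (a + 1) Γ A)
    (hD : D.Linear) : ∃ D' Ds, Cut Γ D D' Ds ∧ (D'.length = 0 → D.length = 0) ∧
      ∀ Γ', CutEnv Γ Γ' D Ds → D'.Typed a Γ' A := by
  induction D generalizing a A Γ with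
  | leaf y =>
    obtain ⟨hle, hty⟩ := h
    by_cases hlevel : (Γ y).level = 0
    · have hy : (leaf y).Typed 0 Γ (.bang (Ty.bang^[a] A)) := by
        simp [Typed, hlevel, hty, Function.iterate_succ_apply']
      refine ⟨_, _, .piece hy, fun _ => rfl, fun Γ' hΓ' => ?_⟩
      simp [Typed, hΓ'.piece _ (List.mem_singleton_self _)]
    · refine ⟨_, _, .inner (Nat.one_le_iff_ne_zero.2 hlevel), fun _ => rfl, fun Γ' hΓ' => ?_⟩
      have hy := hΓ'.inner y (Finset.mem_singleton_self y) (Nat.one_le_iff_ne_zero.2 hlevel)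
      simp only [Typed, hy, hty]
      exact ⟨by omega, by congr 1; omega⟩
  | lam S D ih =>
    obtain ⟨hle, B, C, rfl, hS, hC⟩ := h
    obtain ⟨D', Ds, hcut, hD'⟩ := BoxTyped.exists_cut hC fun _ _ hB => ih hB hD.2
    refine ⟨_, _, hcut.lam, by simp [length], fun Γ' hΓ' =>
      ⟨hΓ'.level_le hcut.lam hD hle, B, C, rfl, hS, hD' _ (hΓ'.piecewise hcut hD.2 hD.1)⟩⟩
  | app D E ihD ihE =>
    obtain ⟨hle, B, hDB, hEB⟩ := h
    obtain ⟨D', Ds, hcutD, hD'⟩ := BoxTyped.exists_cut hDB fun _ _ h => ihD h hD.2.1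
    obtain ⟨E', Es, hcutE, hE'⟩ := BoxTyped.exists_cut hEB fun _ _ h => ihE h hD.2.2
    refine ⟨_, _, hcutD.app hcutE, by simp [length], fun Γ' hΓ' =>
      ⟨hΓ'.level_le (hcutD.app hcutE) hD hle, B, hD' Γ' ?_, hE' Γ' ?_⟩⟩
    · exact ⟨fun y hy => hΓ'.inner y (Finset.mem_union_left _ hy),
        fun p hp => hΓ'.piece p (List.mem_append_left _ hp)⟩
    · exact ⟨fun y hy => hΓ'.inner y (Finset.mem_union_right _ hy),
        fun p hp => hΓ'.piece p (List.mem_append_right _ hp)⟩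

end Skel

/-! ### Splitting bases -/

open Classical in
/-- The part of a base that concerns the variables in `s`. -/
noncomputable def Ctx.restrict (Ξ : Ctx) (s : Set ℕ) : Ctx := s.piecewise Ξ fun _ => none

open Classical in
theorem Ctx.restrict_eqOn (Ξ : Ctx) (s : Set ℕ) : Set.EqOn (Ξ.restrict s) Ξ s :=
  Set.piecewise_eqOn _ _ _

open Classical in
theorem Ctx.mem_of_restrict_ne_none {Ξ : Ctx} {s : Set ℕ} {x : ℕ} (h : Ξ.restrict s x ≠ none) :
    x ∈ s := by
  by_contra hx
  exact h (Set.piecewise_eq_of_notMem _ _ _ hx)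

theorem Ctx.isUnion_restrict {ι : Type} (Ξ : Ctx) {s : ι → Set ℕ}
    (hdisj : ∀ i j x, x ∈ s i → x ∈ s j → i = j) (hcover : ∀ x, ∃ i, x ∈ s i) :
    Ξ.IsUnion fun i => Ξ.restrict (s i) := by
  refine ⟨fun i j x hi hj => hdisj i j x (mem_of_restrict_ne_none hi) (mem_of_restrict_ne_none hj),
    fun x A => ⟨fun h => ?_, ?_⟩⟩
  · obtain ⟨i, hi⟩ := hcover x
    exact ⟨i, (Ξ.restrict_eqOn _ hi).trans h⟩
  · rintro ⟨i, hi⟩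
    rwa [← Ξ.restrict_eqOn _ (mem_of_restrict_ne_none (hi ▸ Option.some_ne_none A))]

theorem Ctx.isUnion_restrict_compl (Ξ : Ctx) (s : Set ℕ) :
    Ξ.IsUnion ![Ξ.restrict s, Ξ.restrict sᶜ] := by
  have h : Ξ.IsUnion fun i => Ξ.restrict (![s, sᶜ] i) := by
    refine Ξ.isUnion_restrict (fun i j x hi hj => ?_) fun x => ?_
    · fin_cases i <;> fin_cases j <;> simp_all
    · by_cases hx : x ∈ s
      · exact ⟨0, hx⟩
      · exact ⟨1, hx⟩
  convert h using 1
  funext i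
  fin_cases i <;> rfl

theorem NEAL.app_of_disjoint {Ξ : Ctx} {s t : Set ℕ} {M N : EATerm} {A B : Ty}
    (hst : Disjoint s t) (hM : ∀ Γ, Set.EqOn Γ Ξ s → NEAL Γ M (.lolli A B))
    (hN : ∀ Γ, Set.EqOn Γ Ξ t → NEAL Γ N A) : NEAL Ξ (.app M N) B :=
  .app (Ξ.isUnion_restrict_compl s) (hM _ (Ξ.restrict_eqOn s))
    (hN _ ((Ξ.restrict_eqOn sᶜ).mono hst.subset_compl_left))

theorem NEAL.contr_var {Ξ : Ctx} {i : ℕ} {N : EATerm} {A B : Ty} (hi : Ξ i = some (.bang A))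
    (hN : ∀ Δ, Set.EqOn Δ Ξ {i}ᶜ → NEAL (Ctx.cons (.bang A) (Ctx.cons (.bang A) Δ)) N B) :
    NEAL Ξ (.contr N (.var i)) B :=
  .contr (Ξ.isUnion_restrict_compl {i})
    (.ax ((Ξ.restrict_eqOn _ (Set.mem_singleton i)).trans hi)) (hN _ (Ξ.restrict_eqOn _))

theorem NEAL.prom_of_disjoint {Ξ : Ctx} {n : ℕ} {s : Fin n → Set ℕ} {N : EATerm}
    {M : Fin n → EATerm} {A : Fin n → Ty} {B : Ty} (hs : ∀ k l x, x ∈ s k → x ∈ s l → k = l)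
    (hM : ∀ k Δ, Set.EqOn Δ Ξ (s k) → NEAL Δ (M k) (.bang (A k)))
    (hN : NEAL (fun i => if h : i < n then some (A ⟨i, h⟩) else none) N B) :
    NEAL Ξ (.prom n N M) (.bang B) := by
  let t : Option (Fin n) → Set ℕ := fun k => k.elim (⋃ k, s k)ᶜ s
  have h : Ξ.IsUnion fun k => Ξ.restrict (t k) := by
    refine Ξ.isUnion_restrict (fun k l x hk hl => ?_) fun x => ?_
    · rcases k with _ | k <;> rcases l with _ | l
      · rfl
      · exact absurd (Set.mem_iUnion_of_mem l hl) hk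
      · exact absurd (Set.mem_iUnion_of_mem k hk) hl
      · exact congrArg some (hs k l x hk hl)
    · by_cases hx : x ∈ ⋃ k, s k
      · exact (Set.mem_iUnion.1 hx).imp' some fun _ => id
      · exact ⟨none, hx⟩
  refine .prom (Γ := Ξ.restrict (t none)) (Δ := fun k => Ξ.restrict (t (some k))) ?_
    (fun k => hM k _ (Ξ.restrict_eqOn _)) hN
  convert h using 1
  funext k
  cases k <;> rfl

/-! ### Elementary terms realizing a skeleton -/

/-- The conditions that a candidate imposes on its subterm `Q`. -/
structure EATerm.Local (Q : EATerm) : Prop where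
  not_redex : ¬ Redex Q
  contr : ∀ M N, Q = .contr M N → (∃ i, N = .var i) ∧ 0 ∈ M.FV ∧ 1 ∈ M.FV
  prom : ∀ n R N, Q = .prom n R N → ∀ i, R ≠ .var i

theorem EATerm.Local.var (i : ℕ) : (EATerm.var i).Local := ⟨nofun, nofun, nofun⟩

/-- `P` is an elementary term of type `T` that realizes the skeleton `D`, where the free
occurrence `y` becomes the variable `ρ y`. -/
structure Realizes (D : Skel) (Γ : Env) (T : Ty) (ρ : ℕ → ℕ) (P : EATerm) : Prop where
  isLocal : ∀ Q, EATerm.Subterm Q P → Q.Local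
  legal : P.Legal
  length_eq : P.length = D.length
  star_eq : P.star = D.toLam fun y => .var (ρ y)
  FV_eq : P.FV = ρ '' D.fv
  typed : ∀ Ξ : Ctx, (∀ y ∈ D.fv, Ξ (ρ y) = some (Γ y).ty) → NEAL Ξ P T

namespace Realizes

variable {D E : Skel} {Γ : Env} {T : Ty} {ρ : ℕ → ℕ} {P Q : EATerm}

theorem candidate (h : Realizes D Γ T ρ P) : P.Candidate where
  legal := h.legal
  normal Q hQ := (h.isLocal Q hQ).not_redex
  simple := by
    refine ⟨fun M N hQ => ?_, ?_⟩
    · obtain ⟨⟨i, rfl⟩, -⟩ := (h.isLocal _ hQ).contr M N rfl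
      exact ⟨i, rfl⟩
    · rw [h.length_eq, h.star_eq, Skel.length_toLam _ fun _ => rfl]
  contr_mem R Q hQ := ((h.isLocal _ hQ).contr R Q rfl).2
  prom_ne_var n R Q hQ := (h.isLocal _ hQ).prom n R Q rfl

theorem disjoint_FV {U : Ty} (hP : Realizes D Γ T ρ P) (hQ : Realizes E Γ U ρ Q) {s : Finset ℕ}
    (hρ : Set.InjOn ρ s) (hD : D.fv ⊆ s) (hE : E.fv ⊆ s) (h : Disjoint D.fv E.fv) :
    Disjoint P.FV Q.FV := by
  rw [hP.FV_eq, hQ.FV_eq, Set.disjoint_iff_inter_eq_empty,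
    ← hρ.image_inter (Finset.coe_subset.2 hD) (Finset.coe_subset.2 hE), ← Finset.coe_inter,
    Finset.disjoint_iff_inter_eq_empty.1 h, Finset.coe_empty, Set.image_empty]

theorem typed_of_eqOn (h : Realizes D Γ T ρ P) {Ξ Ξ' : Ctx}
    (hΞ : ∀ y ∈ D.fv, Ξ (ρ y) = some (Γ y).ty) (heq : Set.EqOn Ξ' Ξ P.FV) : NEAL Ξ' P T :=
  h.typed Ξ' fun y hy => (heq (h.FV_eq ▸ Set.mem_image_of_mem ρ hy)).trans (hΞ y hy)

theorem leaf (y : ℕ) (Γ : Env) (ρ : ℕ → ℕ) : Realizes (.leaf y) Γ (Γ y).ty ρ (.var (ρ y)) where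
  isLocal Q hQ := by
    cases hQ
    exact .var _
  legal := trivial
  length_eq := rfl
  star_eq := rfl
  FV_eq := by simp [EATerm.FV, Skel.fv]
  typed Ξ h := .ax (h y (Finset.mem_singleton_self y))

theorem lam {S : Finset ℕ} {a : ℕ} {A B : Ty}
    (h : Realizes D (S.piecewise (fun _ => ⟨a, A⟩) Γ) B (S.piecewise 0 fun y => ρ y + 1) P)
    (hP : ∀ M N, P = .contr M N → N = .var 0) :
    Realizes (.lam S D) Γ (.lolli A B) ρ (.lam P) where
  isLocal Q hQ := by
    cases hQ with
    | refl =>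
      refine ⟨fun hredex => ?_, nofun, nofun⟩
      cases hredex with
      | lamContr M N h0 => exact h0 (hP M N rfl ▸ rfl)
    | lam hQ => exact h.isLocal Q hQ
  legal := h.legal
  length_eq := congrArg (1 + ·) h.length_eq
  star_eq := by
    refine congrArg Lam.lam (h.star_eq.trans (Skel.toLam_congr _ fun y _ => ?_))
    by_cases hyS : y ∈ S <;> simp [hyS, Lam.rename]
  FV_eq := by
    ext i
    simp only [EATerm.FV, h.FV_eq, Skel.fv, Set.mem_ofPred_eq, Set.mem_image, Finset.mem_coe,
      Finset.mem_sdiff]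
    refine exists_congr fun y => ?_
    by_cases hyS : y ∈ S <;> simp [hyS]
  typed Ξ hΞ := by
    refine .lam (h.typed _ fun y hy => ?_)
    by_cases hyS : y ∈ S
    · simp [hyS, Ctx.cons]
    · simpa [hyS, Ctx.cons] using hΞ y (Finset.mem_sdiff.2 ⟨hy, hyS⟩)

theorem app {A B : Ty} (hP : Realizes D Γ (.lolli A B) ρ P) (hQ : Realizes E Γ A ρ Q)
    (hdisj : Disjoint D.fv E.fv) (hρ : Set.InjOn ρ (Skel.app D E).fv)
    (hP' : ∀ M N, P ≠ .contr M N) (hQ' : ∀ M N, Q ≠ .contr M N) :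
    Realizes (.app D E) Γ B ρ (.app P Q) := by
  have hFV : Disjoint P.FV Q.FV :=
    hP.disjoint_FV hQ hρ Finset.subset_union_left Finset.subset_union_right hdisj
  refine ⟨fun R hR => ?_, ⟨hP.legal, hQ.legal, hFV⟩, ?_, ?_, ?_, fun Ξ hΞ => ?_⟩
  · cases hR with
    | refl =>
      refine ⟨fun hredex => ?_, nofun, nofun⟩
      cases hredex with
      | appContrL => exact hP' _ _ rfl
      | appContrR => exact hQ' _ _ rfl
    | appL hR => exact hP.isLocal R hR
    | appR hR => exact hQ.isLocal R hR
  · simp only [EATerm.length, Skel.length, hP.length_eq, hQ.length_eq]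
  · simp only [EATerm.star, Skel.toLam, hP.star_eq, hQ.star_eq]
  · simp only [EATerm.FV, Skel.fv, hP.FV_eq, hQ.FV_eq, Finset.coe_union, Set.image_union]
  · exact .app_of_disjoint hFV
      (fun _ => hP.typed_of_eqOn fun y hy => hΞ y (Finset.mem_union_left _ hy))
      (fun _ => hQ.typed_of_eqOn fun y hy => hΞ y (Finset.mem_union_right _ hy))

end Realizes

/-! ### Contractions -/

/-- The renaming `ρ`, changed so that the occurrence `y` gets the first, and the other occurrences
with the same image get the second of two new variables. -/
def separate (ρ : ℕ → ℕ) (y : ℕ) : ℕ → ℕ :=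
  fun x => if x = y then 0 else if ρ x = ρ y then 1 else ρ x + 2

/-- The renaming that substitutes `i` for the first two variables. -/
def merge (i : ℕ) : ℕ → ℕ := fun j => if j < 2 then i else j - 2

theorem merge_separate (ρ : ℕ → ℕ) (y x : ℕ) : merge (ρ y) (separate ρ y x) = ρ x := by
  unfold merge separate
  split_ifs <;> first | omega | simp_all

theorem separate_self (ρ : ℕ → ℕ) (y : ℕ) : separate ρ y y = 0 := if_pos rfl

theorem separate_of_ne {ρ : ℕ → ℕ} {y z : ℕ} (hne : z ≠ y) (h : ρ z = ρ y) :
    separate ρ y z = 1 := by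
  simp [separate, hne, h]

theorem separate_eq_add_two_iff {ρ : ℕ → ℕ} {y x i : ℕ} :
    separate ρ y x = i + 2 ↔ ρ x = i ∧ i ≠ ρ y := by
  unfold separate
  split_ifs with h₁ h₂
  · subst h₁
    exact ⟨nofun, fun h => absurd h.1.symm h.2⟩
  · omega
  · omega

theorem card_image_lt_card_image_separate {s : Finset ℕ} {ρ : ℕ → ℕ} {y z : ℕ} (hy : y ∈ s)
    (hz : z ∈ s) (hne : y ≠ z) (h : ρ y = ρ z) :
    (s.image ρ).card < (s.image (separate ρ y)).card := by
  have himage : s.image ρ = (s.image (separate ρ y)).image (merge (ρ y)) := by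
    rw [Finset.image_image]
    exact Finset.image_congr fun x _ => (merge_separate ρ y x).symm
  rw [himage]
  refine Finset.card_image_le.lt_of_ne fun hcard => ?_
  have heq := Finset.card_image_iff.1 hcard (Finset.mem_image_of_mem (separate ρ y) hy)
    (Finset.mem_image_of_mem (separate ρ y) hz) (by rw [merge_separate, merge_separate, h])
  rw [separate_self, separate_of_ne hne.symm h.symm] at heq
  exact zero_ne_one heq

theorem Realizes.contr {D : Skel} {Γ : Env} {T A : Ty} {ρ : ℕ → ℕ} {P : EATerm} {y z : ℕ}
    (h : Realizes D Γ T (separate ρ y) P) (hy : y ∈ D.fv) (hz : z ∈ D.fv) (hne : y ≠ z)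
    (hyz : ρ y = ρ z) (hA : ∀ x ∈ D.fv, ρ x = ρ y → (Γ x).ty = .bang A) :
    Realizes D Γ T ρ (.contr P (.var (ρ y))) := by
  have hFV : ∀ x, x + 2 ∈ P.FV ↔ x ∈ ρ '' D.fv ∧ x ≠ ρ y := fun x => by
    simp only [h.FV_eq, Set.mem_image, separate_eq_add_two_iff, ← and_assoc, exists_and_right]
  refine ⟨fun Q hQ => ?_, ⟨h.legal, trivial, ?_⟩, h.length_eq, ?_, ?_, fun Ξ hΞ => ?_⟩
  · cases hQ with
    | refl =>
      refine ⟨nofun, ?_, nofun⟩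
      rintro M N ⟨⟩
      rw [h.FV_eq]
      exact ⟨⟨_, rfl⟩, ⟨y, hy, separate_self ρ y⟩, ⟨z, hz, separate_of_ne hne.symm hyz.symm⟩⟩
    | contrBody hQ => exact h.isLocal Q hQ
    | contrArg hQ =>
      cases hQ
      exact .var _
  · exact Set.disjoint_left.2 fun x hx hxy => ((hFV x).1 hx).2 hxy
  · have hmerge : (fun i => if i < 2 then (EATerm.var (ρ y)).star else .var (i - 2)) =
        fun i => Lam.var (merge (ρ y) i) := by
      funext i
      exact (apply_ite Lam.var _ _ _).symm
    rw [EATerm.star, h.star_eq, hmerge, Skel.toLam_subst]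
    simp only [Lam.subst, merge_separate]
  · ext x
    simp only [EATerm.FV, Set.mem_union, Set.mem_ofPred_eq, hFV, Set.mem_singleton_iff]
    by_cases hx : x = ρ y
    · simpa [hx] using ⟨y, hy, rfl⟩
    · simp [hx]
  · refine .contr_var ((hΞ y hy).trans (congrArg some (hA y hy rfl)))
      fun Δ hΔ => h.typed _ fun x hx => ?_
    unfold separate
    split_ifs with hxy hρ
    · exact congrArg some (hA x hx (by rw [hxy])).symm
    · exact congrArg some (hA x hx hρ).symm
    · exact (hΔ hρ).trans (hΞ x hx)

theorem exists_realizes_of_injOn {D : Skel} {Γ : Env} {T : Ty}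
    (h : ∀ ρ : ℕ → ℕ, Set.InjOn ρ D.fv → ∃ P, Realizes D Γ T ρ P ∧ ∀ M N, P ≠ .contr M N)
    (ρ : ℕ → ℕ) (hρ : ∀ y ∈ D.fv, ∀ z ∈ D.fv, y ≠ z → ρ y = ρ z →
      (Γ y).ty = (Γ z).ty ∧ ∃ A, (Γ y).ty = .bang A) :
    ∃ P, Realizes D Γ T ρ P ∧ ∀ M N, P = .contr M N →
      ∃ y ∈ D.fv, ∃ z ∈ D.fv, y ≠ z ∧ ρ y = ρ z ∧ N = .var (ρ y) := by
  induction hk : D.fv.card - (D.fv.image ρ).card using Nat.strong_induction_on generalizing ρ with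
  | _ k ih =>
  by_cases hinj : Set.InjOn ρ D.fv
  · obtain ⟨P, hP, hcontr⟩ := h ρ hinj
    exact ⟨P, hP, fun M N hPMN => absurd hPMN (hcontr M N)⟩
  simp only [Set.InjOn, not_forall, Finset.mem_coe] at hinj
  obtain ⟨y, hy, z, hz, hyz, hne⟩ := hinj
  obtain ⟨A, hA⟩ := (hρ y hy z hz hne hyz).2
  have hlt := card_image_lt_card_image_separate hy hz hne hyz
  have hle : (D.fv.image (separate ρ y)).card ≤ D.fv.card := Finset.card_image_le
  have hseparate : ∀ u v, separate ρ y u = separate ρ y v → ρ u = ρ v := fun u v huv => by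
    rw [← merge_separate ρ y u, huv, merge_separate]
  obtain ⟨P, hP, -⟩ := ih _ (by omega) (separate ρ y)
    (fun u hu v hv huv heq => hρ u hu v hv huv (hseparate u v heq)) rfl
  refine ⟨_, hP.contr (A := A) hy hz hne hyz fun x hx hxy => ?_, ?_⟩
  · rcases eq_or_ne x y with rfl | hxne
    · exact hA
    · exact (hρ x hx y hy hxne hxy).1.trans hA
  · rintro M N ⟨⟩
    exact ⟨y, hy, z, hz, hne, hyz, rfl⟩

/-! ### Boxes -/

namespace Cut

variable {Γ : Env} {D D' : Skel} {Ds : List Piece}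

theorem mem_fv_iff_exists_name (h : Cut Γ D D' Ds) (hD : D.Linear)
    (hlevel : ∀ y ∈ D.fv, (Γ y).level = 0) (y : ℕ) :
    y ∈ D'.fv ↔ ∃ k : Fin Ds.length, Ds[k].skel.name = y := by
  have hy : ¬(y ∈ D.fv ∧ 1 ≤ (Γ y).level) := fun hy => by
    have := hlevel y hy.1
    omega
  rw [h.mem_fv_iff hD, or_iff_right hy, List.exists_mem_iff_getElem, Fin.exists_iff]
  rfl

theorem index_eq_of_mem_leaves (h : Cut Γ D D' Ds) (hD : D.Linear) {k l : Fin Ds.length} {y : ℕ}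
    (hk : y ∈ Ds[k].skel.leaves) (hl : y ∈ Ds[l].skel.leaves) : k = l := by
  have hdisj := List.pairwise_iff_getElem.1 (h.piece_pairwise_disjoint hD)
  by_contra hkl
  rcases lt_or_gt_of_ne hkl with hlt | hlt
  · exact Finset.disjoint_left.1 (hdisj k l k.2 l.2 hlt) hk hl
  · exact Finset.disjoint_left.1 (hdisj l k l.2 k.2 hlt) hl hk

theorem injective_name (h : Cut Γ D D' Ds) (hD : D.Linear) :
    Function.Injective fun k : Fin Ds.length => Ds[k].skel.name :=
  fun k l (hkl : Ds[k].skel.name = Ds[l].skel.name) =>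
    h.index_eq_of_mem_leaves hD (Skel.name_mem_leaves _) (hkl ▸ Skel.name_mem_leaves _)

variable {T : Ty} {Γ' : Env} {ρ ρ' : ℕ → ℕ} {P : EATerm} {Q : Fin Ds.length → EATerm}

theorem FV_eq_setOf_lt (h : Cut Γ D D' Ds) (hD : D.Linear)
    (hlevel : ∀ y ∈ D.fv, (Γ y).level = 0) (hρ' : ∀ k : Fin Ds.length, ρ' Ds[k].skel.name = k)
    (hP : Realizes D' Γ' T ρ' P) : P.FV = {i | i < Ds.length} := by
  ext i
  simp only [hP.FV_eq, Set.mem_image, Finset.mem_coe, h.mem_fv_iff_exists_name hD hlevel,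
    Set.mem_ofPred_eq]
  constructor
  · rintro ⟨_, ⟨k, rfl⟩, rfl⟩
    exact (hρ' k).trans_lt k.2
  · exact fun hi => ⟨_, ⟨⟨i, hi⟩, rfl⟩, hρ' ⟨i, hi⟩⟩

theorem index_eq_of_mem_FV (h : Cut Γ D D' Ds) (hD : D.Linear) (hρ : Set.InjOn ρ D.fv)
    (hQ : ∀ k, Realizes Ds[k].skel Γ (.bang Ds[k].ty) ρ (Q k)) (k l : Fin Ds.length) (x : ℕ)
    (hk : x ∈ (Q k).FV) (hl : x ∈ (Q l).FV) : k = l := by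
  rw [(hQ _).FV_eq] at hk hl
  obtain ⟨y, hy, rfl⟩ := hk
  obtain ⟨z, hz, hzy⟩ := hl
  obtain rfl : z = y := hρ (h.piece_fv_subset _ (List.getElem_mem _) hz)
    (h.piece_fv_subset _ (List.getElem_mem _) hy) hzy
  exact h.index_eq_of_mem_leaves hD (Skel.fv_subset_leaves _ hy) (Skel.fv_subset_leaves _ hz)

theorem iUnion_FV (h : Cut Γ D D' Ds) (hlevel : ∀ y ∈ D.fv, (Γ y).level = 0)
    (hQ : ∀ k, Realizes Ds[k].skel Γ (.bang Ds[k].ty) ρ (Q k)) : ⋃ k, (Q k).FV = ρ '' D.fv := by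
  refine subset_antisymm (Set.iUnion_subset fun k => ?_) ?_
  · rw [(hQ k).FV_eq]
    exact Set.image_mono (Finset.coe_subset.2 (h.piece_fv_subset _ (List.getElem_mem _)))
  · rintro _ ⟨y, hy, rfl⟩
    obtain ⟨p, hp, hyp⟩ := h.exists_piece y hy (hlevel y hy)
    obtain ⟨k, hk, rfl⟩ := List.getElem_of_mem hp
    exact Set.mem_iUnion_of_mem ⟨k, hk⟩ ((hQ _).FV_eq ▸ Set.mem_image_of_mem ρ hyp)

theorem star_prom (h : Cut Γ D D' Ds) (hD : D.Linear) (hlevel : ∀ y ∈ D.fv, (Γ y).level = 0)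
    (hρ' : ∀ k : Fin Ds.length, ρ' Ds[k].skel.name = k) (hP : Realizes D' Γ' T ρ' P)
    (hQ : ∀ k, Realizes Ds[k].skel Γ (.bang Ds[k].ty) ρ (Q k)) :
    (EATerm.prom Ds.length P Q).star = D.toLam fun y => .var (ρ y) := by
  rw [EATerm.star, hP.star_eq, Skel.toLam_subst]
  refine h.toLam_eq hD (fun y hy hle => absurd (hlevel y hy) (by omega)) fun p hp => ?_
  obtain ⟨k, hk, rfl⟩ := List.getElem_of_mem hp
  have hname : ρ' Ds[k].skel.name = k := hρ' ⟨k, hk⟩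
  rw [Lam.subst, hname, dif_pos hk]
  exact (hQ ⟨k, hk⟩).star_eq

theorem length_prom (h : Cut Γ D D' Ds) (hP : Realizes D' Γ' T ρ' P)
    (hQ : ∀ k, Realizes Ds[k].skel Γ (.bang Ds[k].ty) ρ (Q k)) :
    (EATerm.prom Ds.length P Q).length = D.length := by
  simp only [EATerm.length, hP.length_eq, (hQ _).length_eq, h.length_eq]
  exact congrArg _ (Fin.sum_univ_fun_getElem Ds fun p => p.skel.length)

theorem realizes_prom (h : Cut Γ D D' Ds) (hD : D.Linear)
    (hlevel : ∀ y ∈ D.fv, (Γ y).level = 0) (hρ : Set.InjOn ρ D.fv)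
    (hρ' : ∀ k : Fin Ds.length, ρ' Ds[k].skel.name = k)
    (hΓ' : ∀ k : Fin Ds.length, Γ' Ds[k].skel.name = ⟨0, Ds[k].ty⟩)
    (hP : Realizes D' Γ' T ρ' P) (hPvar : ∀ i, P ≠ .var i)
    (hQ : ∀ k, Realizes Ds[k].skel Γ (.bang Ds[k].ty) ρ (Q k))
    (hQcontr : ∀ k M N, Q k ≠ .contr M N) (hQprom : ∀ k n M N, Q k ≠ .prom n M N) :
    Realizes D Γ (.bang T) ρ (.prom Ds.length P Q) := by
  have hFV := h.FV_eq_setOf_lt hD hlevel hρ' hP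
  have hindex := h.index_eq_of_mem_FV hD hρ hQ
  refine ⟨fun R hR => ?_, ⟨hP.legal, fun k => (hQ k).legal, hFV, fun k l hkl => ?_⟩,
    h.length_prom hP hQ, h.star_prom hD hlevel hρ' hP hQ, ?_, fun Ξ hΞ => ?_⟩
  · cases hR with
    | refl =>
      refine ⟨fun hredex => ?_, nofun, ?_⟩
      · cases hredex with
        | bangBang _ _ _ k _ _ _ hk => exact hQprom k _ _ _ hk
        | bangContr _ _ _ k _ _ hk => exact hQcontr k _ _ hk
      · rintro n R N ⟨⟩
        exact hPvar
    | promBody hR => exact hP.isLocal R hR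
    | promArg k hR => exact (hQ k).isLocal R hR
  · exact Set.disjoint_left.2 fun x hk hl => hkl (hindex k l x hk hl)
  · simp [EATerm.FV, hFV, h.iUnion_FV hlevel hQ]
  · refine .prom_of_disjoint hindex (fun k _ => (hQ k).typed_of_eqOn fun y hy =>
      hΞ y (h.piece_fv_subset _ (List.getElem_mem _) hy)) (hP.typed _ fun y hy => ?_)
    obtain ⟨k, rfl⟩ := (h.mem_fv_iff_exists_name hD hlevel y).1 hy
    rw [hρ', dif_pos k.2, hΓ']

end Cut

/-! ### Every typed skeleton is realized -/

namespace Skel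

/-- Every way of naming the free occurrences of `D` apart turns `D` into an elementary term of type
`!^a A`, of which the last conditions say which terms it may be substituted in. -/
def Realizable (D : Skel) (a : ℕ) (Γ : Env) (A : Ty) : Prop :=
  ∀ ρ : ℕ → ℕ, Set.InjOn ρ D.fv → ∃ P, Realizes D Γ (Ty.bang^[a] A) ρ P ∧
    (∀ M N, P ≠ .contr M N) ∧ (a = 0 → ∀ n M N, P ≠ .prom n M N) ∧
    (D.length ≠ 0 → ∀ i, P ≠ .var i)

theorem Typed.realizable_leaf {y : ℕ} {Γ : Env} {A : Ty} (h : (leaf y).Typed 0 Γ A) :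
    (leaf y).Realizable 0 Γ A := by
  intro ρ _
  have hP := Realizes.leaf y Γ ρ
  rw [h.2, Nat.zero_sub] at hP
  exact ⟨_, hP, nofun, fun _ => nofun, fun h => absurd rfl h⟩

theorem AcrossBoxes.exists_realizes {D : Skel} {Γ : Env} {A : Ty}
    (h : D.AcrossBoxes (fun b => D.Realizable b Γ) 0 A) {ρ : ℕ → ℕ} (hρ : Set.InjOn ρ D.fv) :
    ∃ P, Realizes D Γ A ρ P ∧ ∀ M N, P ≠ .contr M N := by
  obtain ⟨b, B, hB, heq, -⟩ := h
  obtain ⟨P, hP, hcontr, -⟩ := hB ρ hρ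
  rw [heq] at hP
  exact ⟨P, hP, hcontr⟩

theorem Realizable.lam {S : Finset ℕ} {D : Skel} {Γ : Env} {A B : Ty}
    (hS : 2 ≤ S.card → ∃ A', A = .bang A')
    (h : D.AcrossBoxes (fun b => D.Realizable b (S.piecewise (fun _ => ⟨0, A⟩) Γ)) 0 B) :
    (lam S D).Realizable 0 Γ (.lolli A B) := by
  intro ρ hρ
  have hcollide : ∀ y ∈ D.fv, ∀ z ∈ D.fv, y ≠ z →
      S.piecewise 0 (fun y => ρ y + 1) y = S.piecewise 0 (fun y => ρ y + 1) z →
      y ∈ S ∧ z ∈ S := by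
    intro y hy z hz hne heq
    by_cases hyS : y ∈ S <;> by_cases hzS : z ∈ S
    · exact ⟨hyS, hzS⟩
    · simp [hyS, hzS] at heq
    · simp [hyS, hzS] at heq
    · exact absurd (hρ (Finset.mem_coe.2 (Finset.mem_sdiff.2 ⟨hy, hyS⟩))
        (Finset.mem_coe.2 (Finset.mem_sdiff.2 ⟨hz, hzS⟩)) (by simpa [hyS, hzS] using heq)) hne
  obtain ⟨P, hP, hcontr⟩ := exists_realizes_of_injOn (fun _ => h.exists_realizes)
    (S.piecewise 0 fun y => ρ y + 1) fun y hy z hz hne heq => by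
      obtain ⟨hyS, hzS⟩ := hcollide y hy z hz hne heq
      simpa [hyS, hzS] using hS (Finset.one_lt_card.2 ⟨y, hyS, z, hzS, hne⟩)
  refine ⟨_, hP.lam fun M N hPMN => ?_, nofun, fun _ => nofun, fun _ => nofun⟩
  obtain ⟨y, hy, z, hz, hne, heq, rfl⟩ := hcontr M N hPMN
  simp [(hcollide y hy z hz hne heq).1]

theorem Realizable.app {D E : Skel} {Γ : Env} {A B : Ty} (hDE : Disjoint D.leaves E.leaves)
    (hD : D.AcrossBoxes (fun b => D.Realizable b Γ) 0 (.lolli A B))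
    (hE : E.AcrossBoxes (fun b => E.Realizable b Γ) 0 A) : (app D E).Realizable 0 Γ B := by
  intro ρ hρ
  obtain ⟨P, hP, hPcontr⟩ :=
    hD.exists_realizes (hρ.mono (Finset.coe_subset.2 Finset.subset_union_left))
  obtain ⟨Q, hQ, hQcontr⟩ :=
    hE.exists_realizes (hρ.mono (Finset.coe_subset.2 Finset.subset_union_right))
  exact ⟨_, hP.app hQ (hDE.mono D.fv_subset_leaves E.fv_subset_leaves) hρ hPcontr hQcontr,
    nofun, fun _ => nofun, fun _ => nofun⟩

theorem Realizable.box {D D' : Skel} {Ds : List Piece} {a : ℕ} {Γ : Env} {A : Ty}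
    (h : Cut Γ D D' Ds) (hD : D.Linear) (hlevel : ∀ y ∈ D.fv, (Γ y).level = 0)
    (hlength : D'.length ≠ 0)
    (hD' : ∀ Γ' : Env, CutEnv Γ Γ' D Ds → (∀ y ∈ D'.fv, (Γ' y).level = 0) →
      D'.Realizable a Γ' A)
    (hDs : ∀ p ∈ Ds, p.skel.Realizable 0 Γ (.bang p.ty)) : D.Realizable (a + 1) Γ A := by
  intro ρ hρ
  have hname := h.injective_name hD
  let Γ' : Env := Function.extend (fun k : Fin Ds.length => Ds[k].skel.name)
    (fun k => ⟨0, Ds[k].ty⟩) Γ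
  let ρ' : ℕ → ℕ := Function.extend (fun k : Fin Ds.length => Ds[k].skel.name) Fin.val 0
  have hΓ' : ∀ k : Fin Ds.length, Γ' Ds[k].skel.name = ⟨0, Ds[k].ty⟩ := hname.extend_apply _ _
  have hρ' : ∀ k : Fin Ds.length, ρ' Ds[k].skel.name = k := hname.extend_apply _ _
  have hinj : Set.InjOn ρ' D'.fv := by
    intro y hy z hz hyz
    obtain ⟨k, rfl⟩ := (h.mem_fv_iff_exists_name hD hlevel y).1 hy
    obtain ⟨l, rfl⟩ := (h.mem_fv_iff_exists_name hD hlevel z).1 hz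
    rw [hρ', hρ', ← Fin.ext_iff] at hyz
    rw [hyz]
  have hcutEnv : CutEnv Γ Γ' D Ds := by
    refine ⟨fun y hy hle => absurd (hlevel y hy) (by omega), fun p hp => ?_⟩
    obtain ⟨k, hk, rfl⟩ := List.getElem_of_mem hp
    exact hΓ' ⟨k, hk⟩
  obtain ⟨P, hP, -, -, hPvar⟩ := hD' Γ' hcutEnv (fun y hy => by
    obtain ⟨k, rfl⟩ := (h.mem_fv_iff_exists_name hD hlevel y).1 hy
    rw [hΓ']) ρ' hinj
  choose Q hQ hQcontr hQprom _ using fun k : Fin Ds.length => hDs Ds[k] (List.getElem_mem _) ρ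
    (hρ.mono (Finset.coe_subset.2 (h.piece_fv_subset _ (List.getElem_mem _))))
  rw [Function.iterate_succ_apply']
  exact ⟨_, h.realizes_prom hD hlevel hρ hρ' hΓ' hP (hPvar hlength) hQ hQcontr
    fun k => hQprom k rfl, nofun, nofun, fun _ => nofun⟩

theorem Typed.realizable {D : Skel} {a : ℕ} {Γ : Env} {A : Ty} (h : D.Typed a Γ A)
    (hD : D.Linear) (hlevel : ∀ y ∈ D.fv, (Γ y).level = 0) (ha : D.length = 0 → a = 0) :
    D.Realizable a Γ A := by
  match a, D with
  | 0, leaf y => exact h.realizable_leaf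
  | 0, lam S D =>
    obtain ⟨-, B, C, rfl, hS, hC⟩ := h
    refine .lam hS (hC.imp fun b _ hb hT => hT.realizable hD.2 (fun y hy => ?_)
      fun h0 => Nat.le_zero.1 (hb h0))
    by_cases hyS : y ∈ S
    · simp [hyS]
    · simpa [hyS] using hlevel y (Finset.mem_sdiff.2 ⟨hy, hyS⟩)
  | 0, app D E =>
    obtain ⟨-, B, hDB, hEB⟩ := h
    exact .app hD.1
      (hDB.imp fun b _ hb hT => hT.realizable hD.2.1
        (fun y hy => hlevel y (Finset.mem_union_left _ hy)) fun h0 => Nat.le_zero.1 (hb h0))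
      (hEB.imp fun b _ hb hT => hT.realizable hD.2.2
        (fun y hy => hlevel y (Finset.mem_union_right _ hy)) fun h0 => Nat.le_zero.1 (hb h0))
  | a + 1, D =>
    obtain ⟨D', Ds, hcut, h0, hD'⟩ := h.exists_cut hD
    have hlength : D'.length ≠ 0 := fun h => Nat.succ_ne_zero a (ha (h0 h))
    have : D'.length ≤ D.length := hcut.length_eq ▸ Nat.le_add_right _ _
    refine .box hcut hD hlevel hlength (fun Γ' hΓ' hlevel' =>
      (hD' Γ' hΓ').realizable (hcut.linear hD) hlevel' fun h => absurd h hlength) fun p hp => ?_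
    have : D'.length + p.skel.length ≤ D.length := hcut.length_eq ▸ Nat.add_le_add_left
      (List.le_sum_of_mem (List.mem_map_of_mem (f := fun p : Piece => p.skel.length) hp)) _
    exact (hcut.piece_typed p hp).realizable (hcut.piece_linear hD p hp) (hcut.piece_level p hp)
      fun _ => rfl
termination_by (D.length, a)
decreasing_by
  all_goals
    simp only [Prod.lex_def, Skel.length]
    omega

theorem BoxTyped.exists_realizes {D : Skel} {Γ : Env} {A : Ty} (h : D.BoxTyped 0 Γ A)
    (hD : D.Linear) (hlevel : ∀ y ∈ D.fv, (Γ y).level = 0) (ρ : ℕ → ℕ)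
    (hρ : ∀ y ∈ D.fv, ∀ z ∈ D.fv, y ≠ z → ρ y = ρ z →
      (Γ y).ty = (Γ z).ty ∧ ∃ A, (Γ y).ty = .bang A) : ∃ P, Realizes D Γ A ρ P := by
  have hreal : D.AcrossBoxes (fun b => D.Realizable b Γ) 0 A :=
    h.imp fun b _ hb hT => hT.realizable hD hlevel fun h0 => Nat.le_zero.1 (hb h0)
  obtain ⟨P, hP, -⟩ := exists_realizes_of_injOn (fun _ => hreal.exists_realizes) ρ hρ
  exact ⟨P, hP⟩

end Skel

/-! ### Computations with fresh names -/

theorem Fresh.bind_eq_some {α β : Type} {x : Fresh α} {f : α → Fresh β} {n m : ℕ} {b : β} :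
    (x >>= f) n = some (b, m) ↔ ∃ a k, x n = some (a, k) ∧ f a k = some (b, m) := by
  change Option.bind (x n) (fun p => f p.1 p.2) = _ ↔ _
  simp only [Option.bind_eq_some_iff, Prod.exists]

theorem Fresh.pure_eq_some {α : Type} {a b : α} {n m : ℕ} :
    (pure a : Fresh α) n = some (b, m) ↔ a = b ∧ n = m := by
  change some (a, n) = _ ↔ _
  simp

theorem Fresh.lift_eq_some {α : Type} {o : Option α} {b : α} {n m : ℕ} :
    (liftM o : Fresh α) n = some (b, m) ↔ o = some b ∧ n = m := by
  change Option.bind o (fun a => some (a, n)) = _ ↔ _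
  cases o <;> simp

theorem fresh_eq_some {n m k : ℕ} : fresh n = some (k, m) ↔ n = k ∧ n + 1 = m := by
  simp [fresh]

theorem process_lt {σ : STy} {n m : ℕ} {Θ : GTy} (h : process σ n = some (Θ, m)) : n < m := by
  induction σ generalizing n m Θ with
  | o =>
    simp only [process, Fresh.bind_eq_some, Fresh.pure_eq_some, fresh_eq_some] at h
    obtain ⟨_, _, ⟨rfl, rfl⟩, _, rfl⟩ := h
    exact n.lt_succ_self
  | arr σ τ ihσ ihτ =>
    simp only [process, Fresh.bind_eq_some, Fresh.pure_eq_some, fresh_eq_some] at h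
    obtain ⟨_, _, ⟨rfl, rfl⟩, _, _, hσ, _, _, hτ, _, rfl⟩ := h
    exact n.lt_succ_self.trans ((ihσ hσ).trans (ihτ hτ))

theorem nameRows_spec {A : List Constr} {n m : ℕ} {R : List Row}
    (h : nameRows A n = some (R, m)) :
    n ≤ m ∧ R.map Row.constr = A ∧ ∀ q ∈ R, q.name ∈ Set.Ico n m := by
  induction A generalizing n m R with
  | nil =>
    simp only [nameRows, Fresh.pure_eq_some] at h
    obtain ⟨rfl, rfl⟩ := h
    simp
  | cons c A ih =>
    simp only [nameRows, Fresh.bind_eq_some, Fresh.pure_eq_some, fresh_eq_some] at h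
    obtain ⟨_, _, ⟨rfl, rfl⟩, R, _, h, rfl, rfl⟩ := h
    obtain ⟨hle, rfl, hname⟩ := ih h
    refine ⟨n.le_succ.trans hle, rfl, List.forall_mem_cons.2 ⟨⟨le_rfl, hle⟩, fun q hq => ?_⟩⟩
    exact Set.Ico_subset_Ico_left n.le_succ (hname q hq)

/-! ### Instances of types and constraints -/

theorem GTy.inst_bang (X : ℕ → ℕ) (n : ℕ) (Θ : GTy) :
    (Θ.bang n).inst X = Ty.bang^[X n] (Θ.inst X) := by
  cases Θ <;> simp [GTy.bang, GTy.inst, Expo.eval, Function.iterate_add_apply]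

theorem GTy.inst_eq_setExpo {X : ℕ → ℕ} {n k : ℕ} {Θ : GTy}
    (h : Expo.eval X Θ.expo = X n + k) : Θ.inst X = Ty.bang^[k] ((Θ.setExpo n).inst X) := by
  cases Θ <;>
    simp only [GTy.expo] at h <;>
    simp only [GTy.setExpo, GTy.inst, h, ← Function.iterate_add_apply] <;>
    simp [Expo.eval, Nat.add_comm]

theorem GTy.exists_inst_eq_bang {X : ℕ → ℕ} {Θ : GTy} (h : 1 ≤ Expo.eval X Θ.expo) :
    ∃ A, Θ.inst X = .bang A := by
  obtain ⟨k, hk⟩ := Nat.exists_eq_add_of_le' h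
  cases Θ <;>
    simp only [GTy.expo] at hk <;>
    simp only [GTy.inst, hk, Function.iterate_succ_apply'] <;>
    exact ⟨_, rfl⟩

/-- `X` satisfies the constraint obtained by subtracting `k` from the left-hand side of `c`, where
inequalities are not modified. -/
def Constr.SatSub (X : ℕ → ℕ) (k : ℕ) : Constr → Prop
  | .eqZero e f => Expo.eval X e = Expo.eval X f + k
  | .geOne e => 1 ≤ Expo.eval X e

theorem Constr.satSub_zero {X : ℕ → ℕ} {c : Constr} : c.SatSub X 0 ↔ c.Sat X := by
  cases c with
  | eqZero e f =>
    simp only [SatSub, Sat]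
    omega
  | geOne e => rfl

theorem Constr.satSub_sub {X : ℕ → ℕ} {k n : ℕ} {c : Constr} :
    (c.sub n).SatSub X k ↔ c.SatSub X (k + X n) := by
  cases c with
  | eqZero e f =>
    simp only [SatSub, sub, Expo.eval, List.map_cons, List.sum_cons]
    omega
  | geOne e => rfl

theorem unify_spec {Θ Δ : GTy} {A : List Constr} (h : unify Θ Δ = some A) :
    ∃ A', A = .eqZero Θ.expo Δ.expo :: A' ∧ ∀ X k,
      Expo.eval X Θ.expo = Expo.eval X Δ.expo + k → IsSolution X A' →
      Θ.inst X = Ty.bang^[k] (Δ.inst X) := by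
  induction Θ generalizing Δ A with
  | base e =>
    cases Δ with
    | base f =>
      obtain rfl : [Constr.eqZero e f] = A := Option.some.inj h
      refine ⟨[], rfl, fun X k hk _ => ?_⟩
      simp only [GTy.expo] at hk
      simp only [GTy.inst, hk, ← Function.iterate_add_apply, Nat.add_comm]
    | arr f Δ₁ Δ₂ => exact absurd h nofun
  | arr e Θ₁ Θ₂ ih₁ ih₂ =>
    cases Δ with
    | base f => exact absurd h nofun
    | arr f Δ₁ Δ₂ =>
      simp only [unify, Option.bind_eq_bind, Option.bind_eq_some_iff, Option.some.injEq] at h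
      obtain ⟨A₁, h₁, A₂, h₂, rfl⟩ := h
      refine ⟨_, rfl, fun X k hk hA => ?_⟩
      obtain ⟨A₁, rfl, hinst₁⟩ := ih₁ h₁
      obtain ⟨A₂, rfl, hinst₂⟩ := ih₂ h₂
      simp only [IsSolution, List.forall_mem_append, List.forall_mem_cons,
        ← Constr.satSub_zero] at hA hinst₁ hinst₂
      have hΘ₁ : Θ₁.inst X = Δ₁.inst X := hinst₁ X 0 hA.1.1 hA.1.2
      have hΘ₂ : Θ₂.inst X = Δ₂.inst X := hinst₂ X 0 hA.2.1 hA.2.2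
      simp only [GTy.expo] at hk
      simp only [GTy.inst, hk, hΘ₁, hΘ₂, ← Function.iterate_add_apply, Nat.add_comm]

theorem unify_inst_eq {Θ Δ : GTy} {A : List Constr} (h : unify Θ Δ = some A) {X : ℕ → ℕ}
    (hA : IsSolution X A) : Θ.inst X = Δ.inst X := by
  obtain ⟨A, rfl, hinst⟩ := unify_spec h
  obtain ⟨hexpo, hA⟩ := List.forall_mem_cons.1 hA
  exact hinst X 0 (Constr.satSub_zero.2 hexpo) hA

theorem unifyAll_inst_eq {Θ : GTy} {Θs : List GTy} {A : List Constr}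
    (h : unifyAll (Θ :: Θs) = some A) {X : ℕ → ℕ} (hA : IsSolution X A) :
    ∀ Δ ∈ Θ :: Θs, Δ.inst X = Θ.inst X := by
  induction Θs generalizing Θ A with
  | nil => simp
  | cons Θ' Θs ih =>
    simp only [unifyAll, Option.bind_eq_bind, Option.bind_eq_some_iff, Option.some.injEq] at h
    obtain ⟨A₁, h₁, A₂, h₂, rfl⟩ := h
    obtain ⟨hA₁, hA₂⟩ := List.forall_mem_append.1 hA
    rw [unify_inst_eq h₁ hA₁]
    exact List.forall_mem_cons.2 ⟨unify_inst_eq h₁ hA₁, ih h₂ hA₂⟩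

theorem contract_inst {Θ : GTy} {Θs : List GTy} {A : List Constr}
    (h : contract (Θ :: Θs) = some A) {X : ℕ → ℕ} (hA : IsSolution X A) :
    (∀ Δ ∈ Θ :: Θs, Δ.inst X = Θ.inst X) ∧ (Θs ≠ [] → ∃ B, Θ.inst X = .bang B) := by
  cases Θs with
  | nil => simp
  | cons Θ' Θs =>
    simp only [contract, Option.bind_eq_bind, Option.bind_eq_some_iff, Option.some.injEq] at h
    obtain ⟨A, h, rfl⟩ := h
    obtain ⟨hexpo, hA⟩ := List.forall_mem_cons.1 hA
    exact ⟨unifyAll_inst_eq h hA, fun _ => GTy.exists_inst_eq_bang hexpo⟩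

theorem contract_filter_inst {B : List Entry} {x : ℕ} {A : List Constr}
    (h : contract ((B.filter fun e => e.var == x).map Entry.ty) = some A) {X : ℕ → ℕ}
    (hA : IsSolution X A) {e e' : Entry} (he : e ∈ B) (hx : e.var = x) (he' : e' ∈ B)
    (hx' : e'.var = x) :
    e.ty.inst X = e'.ty.inst X ∧ (e ≠ e' → ∃ C, e.ty.inst X = .bang C) := by
  have hmem : e ∈ B.filter fun e => e.var == x := List.mem_filter.2 ⟨he, by simpa using hx⟩
  have hmem' : e' ∈ B.filter fun e => e.var == x := List.mem_filter.2 ⟨he', by simpa using hx'⟩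
  generalize (B.filter fun e => e.var == x) = Bx at h hmem hmem'
  cases Bx with
  | nil => exact absurd hmem List.not_mem_nil
  | cons e₀ es =>
    obtain ⟨heq, hbang⟩ := contract_inst h hA
    have hinst : ∀ e ∈ e₀ :: es, e.ty.inst X = e₀.ty.inst X :=
      fun e he => heq _ (List.mem_map_of_mem (f := Entry.ty) he)
    refine ⟨(hinst e hmem).trans (hinst e' hmem').symm, fun hne => ?_⟩
    rw [hinst e hmem]
    refine hbang fun hes => hne ?_
    rw [List.map_eq_nil_iff.1 hes, List.mem_singleton] at hmem hmem'
    exact hmem.trans hmem'.symm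

/-! ### Multisets of slices -/

/-- The number of slices in `w` to which the constraint named `j` belongs. -/
def rowCount (w : Multiset Slice) (j : ℕ) : ℕ := w.countP fun sl => sl.hasRow j

/-- The number of slices in `w` to which the variable occurrence `y` belongs. -/
def occCount (w : Multiset Slice) (y : ℕ) : ℕ := w.countP fun sl => sl.hasOcc y

theorem rowCount_add (w w' : Multiset Slice) : rowCount (w + w') = rowCount w + rowCount w' :=
  funext fun _ => Multiset.countP_add _ w w'

theorem occCount_add (w w' : Multiset Slice) : occCount (w + w') = occCount w + occCount w' :=
  funext fun _ => Multiset.countP_add _ w w'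

theorem occCount_le_card (w : Multiset Slice) (y : ℕ) : occCount w y ≤ w.card :=
  Multiset.countP_le_card _ w

theorem rowCount_replicate (k : ℕ) (sl : Slice) (j : ℕ) :
    rowCount (Multiset.replicate k sl) j = if sl.hasRow j then k else 0 := by
  simp [rowCount, ← Multiset.coe_replicate, List.countP_replicate]

theorem occCount_replicate (k : ℕ) (sl : Slice) (y : ℕ) :
    occCount (Multiset.replicate k sl) y = if sl.hasOcc y then k else 0 := by
  simp [occCount, ← Multiset.coe_replicate, List.countP_replicate]

namespace Slice

/-- The constraints of the slice are named in `I` and its variable occurrences belong to `J`. -/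
def In (I J : Set ℕ) (sl : Slice) : Prop := ∀ p ∈ sl, p.1 ∈ I ∧ ∀ y ∈ p.2, y ∈ J

theorem In.mono {I J I' J' : Set ℕ} {sl : Slice} (h : sl.In I J) (hI : I ⊆ I') (hJ : J ⊆ J') :
    sl.In I' J' :=
  fun p hp => ⟨hI (h p hp).1, fun y hy => hJ ((h p hp).2 y hy)⟩

theorem In.append {I J : Set ℕ} {s t : Slice} (hs : s.In I J) (ht : t.In I J) :
    In I J (s ++ t) :=
  List.forall_mem_append.2 ⟨hs, ht⟩

theorem in_of_eq_nil_or_mem {I J : Set ℕ} {C : List Slice} (hC : ∀ sl ∈ C, sl.In I J) {sl : Slice}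
    (h : sl = [] ∨ sl ∈ C) : sl.In I J := by
  rcases h with rfl | h
  exacts [nofun, hC sl h]

theorem In.hasRow_eq_false {I J : Set ℕ} {sl : Slice} (h : sl.In I J) {j : ℕ} (hj : j ∉ I) :
    sl.hasRow j = false :=
  List.any_eq_false.2 fun p hp hpj => hj ((beq_iff_eq.1 hpj) ▸ (h p hp).1)

theorem In.hasOcc_eq_false {I J : Set ℕ} {sl : Slice} (h : sl.In I J) {y : ℕ} (hy : y ∉ J) :
    sl.hasOcc y = false :=
  List.any_eq_false.2 fun p hp hpy => hy ((h p hp).2 y (by simpa using hpy))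

theorem hasRow_append (j : ℕ) (s t : Slice) : hasRow (s ++ t) j = (s.hasRow j || t.hasRow j) :=
  List.any_append

theorem hasOcc_append (y : ℕ) (s t : Slice) : hasOcc (s ++ t) y = (s.hasOcc y || t.hasOcc y) :=
  List.any_append

end Slice

theorem rowCount_eq_zero {I J : Set ℕ} {w : Multiset Slice} (h : ∀ sl ∈ w, sl.In I J) {j : ℕ}
    (hj : j ∉ I) : rowCount w j = 0 :=
  Multiset.countP_eq_zero.2 fun sl hsl => by simp [(h sl hsl).hasRow_eq_false hj]

/-- The slices `C`, together with one consisting of the critical point `(j, ys)` if `b` holds. -/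
def addCpt (b : Bool) (j : ℕ) (ys : List ℕ) (C : List Slice) : List Slice :=
  if b then C ++ [[(j, ys)]] else C

theorem addCpt_in {b : Bool} {j : ℕ} {ys : List ℕ} {C : List Slice} {I J : Set ℕ}
    (hC : ∀ sl ∈ C, sl.In I J) (hj : j ∈ I) (hys : ∀ y ∈ ys, y ∈ J) :
    ∀ sl ∈ addCpt b j ys C, sl.In I J := by
  cases b with
  | false => exact hC
  | true =>
    refine List.forall_mem_append.2 ⟨hC, ?_⟩
    simpa only [List.mem_singleton, forall_eq, Slice.In] using ⟨hj, hys⟩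

theorem exists_eq_add_replicate_of_addCpt {b : Bool} {j : ℕ} {ys : List ℕ} {C : List Slice}
    {w : Multiset Slice} (h : ∀ sl ∈ w, sl ∈ addCpt b j ys C) :
    ∃ w' k, (∀ sl ∈ w', sl ∈ C) ∧ w = w' + Multiset.replicate k [(j, ys)] := by
  refine ⟨w.filter (· ∈ C), (w.filter (· ∉ C)).card, fun sl hsl => Multiset.of_mem_filter hsl, ?_⟩
  have hnew : ∀ sl ∈ w.filter (· ∉ C), sl = [(j, ys)] := fun sl hsl => by
    obtain ⟨hw, hC⟩ := Multiset.mem_filter.1 hsl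
    cases b with
    | false => exact absurd (h sl hw) hC
    | true => simpa [hC] using List.mem_append.1 (h sl hw)
  rw [← Multiset.eq_replicate_card.2 hnew, Multiset.filter_add_not]

theorem mem_prodUnion {C₁ C₂ : List Slice} {sl : Slice} (h : sl ∈ prodUnion C₁ C₂) :
    ∃ s t : Slice, (s = [] ∨ s ∈ C₁) ∧ (t = [] ∨ t ∈ C₂) ∧ sl = s ++ t := by
  induction C₁ with
  | nil => exact ⟨[], sl, .inl rfl, .inr h, rfl⟩
  | cons s C₁ ih =>
    cases C₂ with
    | nil => exact ⟨sl, [], .inr h, .inl rfl, (List.append_nil sl).symm⟩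
    | cons t C₂ =>
      rcases List.mem_append.1 h with h | h
      · rcases List.mem_cons.1 h with rfl | h
        · exact ⟨sl, [], .inr List.mem_cons_self, .inl rfl, (List.append_nil sl).symm⟩
        · obtain ⟨u, hu, rfl⟩ := List.mem_map.1 h
          exact ⟨s, u, .inr List.mem_cons_self, .inr hu, rfl⟩
      · obtain ⟨u, v, hu, hv, rfl⟩ := ih h
        exact ⟨u, v, hu.imp_right (List.mem_cons_of_mem s), hv, rfl⟩

theorem prodUnion_in {C₁ C₂ : List Slice} {I J : Set ℕ} (h₁ : ∀ sl ∈ C₁, sl.In I J)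
    (h₂ : ∀ sl ∈ C₂, sl.In I J) : ∀ sl ∈ prodUnion C₁ C₂, sl.In I J := by
  intro sl hsl
  obtain ⟨s, t, hs, ht, rfl⟩ := mem_prodUnion hsl
  exact (Slice.in_of_eq_nil_or_mem h₁ hs).append (Slice.in_of_eq_nil_or_mem h₂ ht)

/-- The multiset `w'` of slices in `C` is what `w` looks like from a subterm whose constraints are
named in `I` and whose variable occurrences belong to `J`. -/
structure Restricts (I J : Set ℕ) (C : List Slice) (w w' : Multiset Slice) : Prop where
  mem : ∀ sl ∈ w', sl ∈ C
  card_le : w'.card ≤ w.card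
  rowCount_eq : ∀ j ∈ I, rowCount w' j = rowCount w j
  occCount_eq : ∀ y ∈ J, occCount w' y = occCount w y

theorem exists_restricts {I J : Set ℕ} {C : List Slice} {w : Multiset Slice}
    (h : ∀ sl ∈ w, ∃ s : Slice, (s = [] ∨ s ∈ C) ∧
      (∀ j ∈ I, s.hasRow j = sl.hasRow j) ∧ ∀ y ∈ J, s.hasOcc y = sl.hasOcc y) :
    ∃ w', Restricts I J C w w' := by
  induction w using Multiset.induction with
  | empty => exact ⟨0, nofun, le_rfl, fun _ _ => rfl, fun _ _ => rfl⟩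
  | cons sl w ih =>
    obtain ⟨w', hw'⟩ := ih fun s hs => h s (Multiset.mem_cons_of_mem hs)
    obtain ⟨s, hs, hrow, hocc⟩ := h sl (Multiset.mem_cons_self sl w)
    rcases hs with rfl | hs
    · refine ⟨w', hw'.mem, ?_, fun j hj => ?_, fun y hy => ?_⟩
      · rw [Multiset.card_cons]
        exact hw'.card_le.trans (Nat.le_succ _)
      · rw [hw'.rowCount_eq j hj, rowCount, rowCount, Multiset.countP_cons_of_neg]
        exact Bool.eq_false_iff.1 (hrow j hj).symm
      · rw [hw'.occCount_eq y hy, occCount, occCount, Multiset.countP_cons_of_neg]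
        exact Bool.eq_false_iff.1 (hocc y hy).symm
    · refine ⟨s ::ₘ w', fun t ht => ?_, ?_, fun j hj => ?_, fun y hy => ?_⟩
      · rcases Multiset.mem_cons.1 ht with rfl | ht
        exacts [hs, hw'.mem t ht]
      · simpa only [Multiset.card_cons, Nat.succ_le_succ_iff] using hw'.card_le
      · simpa only [rowCount, Multiset.countP_cons, hrow j hj, Nat.add_right_cancel_iff]
          using hw'.rowCount_eq j hj
      · simpa only [occCount, Multiset.countP_cons, hocc y hy, Nat.add_right_cancel_iff]
          using hw'.occCount_eq y hy

section ProdUnion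

variable {C₁ C₂ : List Slice} {w : Multiset Slice} {I₁ I₂ J₁ J₂ : Set ℕ}

theorem exists_restricts_left_of_prodUnion (hw : ∀ sl ∈ w, sl ∈ prodUnion C₁ C₂)
    (h₂ : ∀ sl ∈ C₂, sl.In I₂ J₂) (hI : Disjoint I₁ I₂) (hJ : Disjoint J₁ J₂) :
    ∃ w₁, Restricts I₁ J₁ C₁ w w₁ := by
  refine exists_restricts fun sl hsl => ?_
  obtain ⟨s, t, hs, ht, rfl⟩ := mem_prodUnion (hw sl hsl)
  have ht : t.In I₂ J₂ := Slice.in_of_eq_nil_or_mem h₂ ht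
  refine ⟨s, hs, fun j hj => ?_, fun y hy => ?_⟩
  · rw [Slice.hasRow_append, ht.hasRow_eq_false (hI.notMem_of_mem_left hj), Bool.or_false]
  · rw [Slice.hasOcc_append, ht.hasOcc_eq_false (hJ.notMem_of_mem_left hy), Bool.or_false]

theorem exists_restricts_right_of_prodUnion (hw : ∀ sl ∈ w, sl ∈ prodUnion C₁ C₂)
    (h₁ : ∀ sl ∈ C₁, sl.In I₁ J₁) (hI : Disjoint I₁ I₂) (hJ : Disjoint J₁ J₂) :
    ∃ w₂, Restricts I₂ J₂ C₂ w w₂ := by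
  refine exists_restricts fun sl hsl => ?_
  obtain ⟨s, t, hs, ht, rfl⟩ := mem_prodUnion (hw sl hsl)
  have hs : s.In I₁ J₁ := Slice.in_of_eq_nil_or_mem h₁ hs
  refine ⟨t, ht, fun j hj => ?_, fun y hy => ?_⟩
  · rw [Slice.hasRow_append, hs.hasRow_eq_false (hI.notMem_of_mem_right hj), Bool.false_or]
  · rw [Slice.hasOcc_append, hs.hasOcc_eq_false (hJ.notMem_of_mem_right hy), Bool.false_or]

end ProdUnion

/-! ### The invariant of type synthesis -/

/-- The variable of which `y` is an occurrence, according to the base `B`. -/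
def baseVar (B : List Entry) (y : ℕ) : ℕ := ((B.find? fun e => e.occ == y).map Entry.var).getD 0

/-- The declarations made by the instance of the base `B`, at level `0`. -/
def baseEnv (X : ℕ → ℕ) (B : List Entry) : Env := fun y =>
  ⟨0, ((B.find? fun e => e.occ == y).map fun e => e.ty.inst X).getD .o⟩

section Base

variable {B : List Entry}

theorem eq_of_occ_eq (hB : (fvo B).Nodup) {e e' : Entry} (he : e ∈ B) (he' : e' ∈ B)
    (h : e.occ = e'.occ) : e = e' :=
  List.inj_on_of_nodup_map hB he he' h

theorem find?_occ_eq (hB : (fvo B).Nodup) {e : Entry} (he : e ∈ B) :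
    B.find? (fun e' => e'.occ == e.occ) = some e := by
  obtain ⟨e', h⟩ := Option.isSome_iff_exists.1
    ((List.find?_isSome (p := fun e' : Entry => e'.occ == e.occ)).2 ⟨e, he, beq_self_eq_true _⟩)
  have hocc : e'.occ = e.occ := by simpa using List.find?_some h
  rw [h, eq_of_occ_eq hB (List.mem_of_find?_eq_some h) he hocc]

theorem baseVar_occ (hB : (fvo B).Nodup) {e : Entry} (he : e ∈ B) : baseVar B e.occ = e.var := by
  rw [baseVar, find?_occ_eq hB he, Option.map_some, Option.getD_some]

theorem baseEnv_occ (X : ℕ → ℕ) (hB : (fvo B).Nodup) {e : Entry} (he : e ∈ B) :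
    baseEnv X B e.occ = ⟨0, e.ty.inst X⟩ := by
  rw [baseEnv, find?_occ_eq hB he, Option.map_some, Option.getD_some]

end Base

/-- `D` is the skeleton of the term `M` on which the algorithm, drawing the fresh names between `n`
and `m`, returns `r`. -/
structure SynthShape (M : Lam) (n m : ℕ) (r : Result) (D : Skel) : Prop where
  le : n ≤ m
  fv_eq : D.fv = (fvo r.base).toFinset
  nodup : (fvo r.base).Nodup
  leaves : ∀ y ∈ D.leaves, y ∈ Set.Ico n m
  linear : D.Linear
  toLam_eq : ∀ ρ : ℕ → ℕ, (∀ e ∈ r.base, ρ e.occ = e.var) → D.toLam (fun y => .var (ρ y)) = M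
  rows : ∀ q ∈ r.rows, q.name ∈ Set.Ico n m
  cpts : ∀ sl ∈ r.cpts, sl.In (Set.Ico n m) (Set.Ico n m)

namespace SynthShape

variable {M : Lam} {n m : ℕ} {r : Result} {D : Skel}

theorem mem_fv (h : SynthShape M n m r D) {y : ℕ} : y ∈ D.fv ↔ y ∈ fvo r.base := by
  rw [h.fv_eq, List.mem_toFinset]

theorem exists_entry (h : SynthShape M n m r D) {y : ℕ} (hy : y ∈ D.fv) :
    ∃ e ∈ r.base, e.occ = y :=
  List.mem_map.1 (h.mem_fv.1 hy)

theorem occ_mem (h : SynthShape M n m r D) : ∀ y ∈ fvo r.base, y ∈ Set.Ico n m :=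
  fun y hy => h.leaves y (D.fv_subset_leaves (h.mem_fv.2 hy))

theorem length_eq (h : SynthShape M n m r D) : D.length = M.length := by
  rw [← h.toLam_eq (baseVar r.base) fun e he => baseVar_occ h.nodup he,
    Skel.length_toLam _ fun _ => rfl]

theorem rows_mono (h : SynthShape M n m r D) {m' : ℕ} (hm : m ≤ m') :
    ∀ q ∈ r.rows, q.name ∈ Set.Ico n m' :=
  fun q hq => Set.Ico_subset_Ico_right hm (h.rows q hq)

theorem cpts_mono (h : SynthShape M n m r D) {m' : ℕ} (hm : m ≤ m') :
    ∀ sl ∈ r.cpts, sl.In (Set.Ico n m') (Set.Ico n m') :=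
  fun sl hsl => (h.cpts sl hsl).mono (Set.Ico_subset_Ico_right hm) (Set.Ico_subset_Ico_right hm)

theorem addCpt_in (h : SynthShape M n m r D) {b : Bool} {j : ℕ} :
    ∀ sl ∈ addCpt b j (fvo r.base) r.cpts, sl.In (insert j (Set.Ico n m)) (Set.Ico n m) :=
  EAL.addCpt_in (fun sl hsl => (h.cpts sl hsl).mono (Set.subset_insert j _) subset_rfl)
    (Set.mem_insert j _) h.occ_mem

end SynthShape

/-- Every constraint of `A` holds under `X`, once `f j` has been subtracted from the left-hand side
of the one named `j`. -/
def RowsSat (X f : ℕ → ℕ) (A : List Row) : Prop := ∀ q ∈ A, q.constr.SatSub X (f q.name)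

/-- Inside `a` boxes the instance of the base `B` is available in `Γ`, provided that `f y` of the
boxes between the declaration of the occurrence `y` and this place are not yet recorded in the type
of `y`. -/
def EnvFits (X f : ℕ → ℕ) (a : ℕ) (B : List Entry) (Γ : Env) : Prop :=
  ∀ e ∈ B, (Γ e.occ).level + f e.occ ≤ a ∧
    (Γ e.occ).ty = Ty.bang^[a - ((Γ e.occ).level + f e.occ)] (e.ty.inst X)

/-- The instance of the result `r` is derivable in the sense of `J`, which takes the number of boxes
around the term, the declarations and the type. This is so for every multiset `w` of slices of `r`:
the boxing function may still add one box through the critical points of each element of `w`, which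
modifies the constraints and types that `r` contains. -/
def SynthTyped (X : ℕ → ℕ) (r : Result) (J : ℕ → Env → Ty → Prop) : Prop :=
  ∀ w : Multiset Slice, (∀ sl ∈ w, sl ∈ r.cpts) → RowsSat X (rowCount w) r.rows →
    ∀ a Γ, w.card ≤ a → EnvFits X (occCount w) a r.base Γ → J a Γ (r.ty.inst X)

theorem RowsSat.congr {X f g : ℕ → ℕ} {A : List Row} (h : RowsSat X f A)
    (hfg : ∀ q ∈ A, f q.name = g q.name) : RowsSat X g A :=
  fun q hq => hfg q hq ▸ h q hq

theorem RowsSat.isSolution {X f : ℕ → ℕ} {A : List Row} (h : RowsSat X f A)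
    (hf : ∀ q ∈ A, f q.name = 0) : IsSolution X (A.map Row.constr) :=
  List.forall_mem_map.2 fun q hq => Constr.satSub_zero.1 (hf q hq ▸ h q hq)

theorem rowsSat_zero {X : ℕ → ℕ} {A : List Row} (h : IsSolution X (A.map Row.constr)) :
    RowsSat X 0 A :=
  fun _ hq => Constr.satSub_zero.2 (h _ (List.mem_map_of_mem hq))

namespace EnvFits

variable {X f g : ℕ → ℕ} {a : ℕ} {B : List Entry} {Γ : Env}

theorem congr (h : EnvFits X f a B Γ) (hfg : ∀ y ∈ fvo B, f y = g y) : EnvFits X g a B Γ :=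
  fun e he => hfg e.occ (List.mem_map_of_mem he) ▸ h e he

theorem level_le (h : EnvFits X f a B Γ) : ∀ y ∈ fvo B, (Γ y).level ≤ a :=
  List.forall_mem_map.2 fun e he => (Nat.le_add_right _ _).trans (h e he).1

theorem of_add_right {k : ℕ} (h : EnvFits X (fun y => f y + k) a B Γ) :
    EnvFits X f (a - k) B Γ := by
  intro e he
  obtain ⟨hle, hty⟩ := h e he
  dsimp only at hle hty
  refine ⟨by omega, hty.trans ?_⟩
  congr 1
  omega

end EnvFits

/-- The result `r` that the algorithm returns on `M`, drawing the fresh names between `n` and `m`,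
is sound for the instantiation `X`. -/
def SynthSound (X : ℕ → ℕ) (M : Lam) (n m : ℕ) (r : Result) : Prop :=
  ∃ D, SynthShape M n m r D ∧ SynthTyped X r D.Typed

theorem SynthTyped.boxTyped {X : ℕ → ℕ} {r : Result} {D : Skel} (ht : SynthTyped X r D.Typed) :
    SynthTyped X r D.BoxTyped :=
  fun w hw hrows a Γ ha hΓ => (ht w hw hrows a Γ ha hΓ).boxTyped

theorem SynthTyped.boxTyped_of_addCpt {X : ℕ → ℕ} {M : Lam} {n m j a : ℕ} {b : Bool} {r : Result}
    {D : Skel} {w : Multiset Slice} {Γ : Env} {T : Ty} (ht : SynthTyped X r D.BoxTyped)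
    (hs : SynthShape M n m r D) (hj : j ∉ Set.Ico n m)
    (hw : ∀ sl ∈ w, sl ∈ addCpt b j (fvo r.base) r.cpts) (hrows : RowsSat X (rowCount w) r.rows)
    (ha : w.card ≤ a) (hΓ : EnvFits X (occCount w) a r.base Γ)
    (hT : r.ty.inst X = Ty.bang^[rowCount w j] T) : D.BoxTyped a Γ T := by
  obtain ⟨w', k, hw', rfl⟩ := exists_eq_add_replicate_of_addCpt hw
  have hrow : ∀ i, rowCount (w' + .replicate k [(j, fvo r.base)]) i =
      rowCount w' i + if j = i then k else 0 := fun i => by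
    simp [rowCount_add, rowCount_replicate, Slice.hasRow]
  have hocc : ∀ y ∈ fvo r.base,
      occCount (w' + .replicate k [(j, fvo r.base)]) y = occCount w' y + k := fun y hy => by
    simp [occCount_add, occCount_replicate, Slice.hasOcc, hy]
  have hk : rowCount (w' + .replicate k [(j, fvo r.base)]) j = k := by
    rw [hrow, if_pos rfl, rowCount_eq_zero (fun sl hsl => hs.cpts sl (hw' sl hsl)) hj, zero_add]
  have hrows' : RowsSat X (rowCount w') r.rows := hrows.congr fun q hq => by
    rw [hrow, if_neg (ne_of_mem_of_not_mem (hs.rows q hq) hj).symm, add_zero]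
  rw [Multiset.card_add, Multiset.card_replicate] at ha
  have h := ht w' hw' hrows' (a - k) Γ (by omega) (hΓ.congr hocc).of_add_right
  rw [hT, hk] at h
  simpa only [Nat.sub_add_cancel (show k ≤ a by omega)] using h.of_bang

/-! ### Boxing -/

/-- The result `r'` arises from `r` by putting `t` boxes around the term. Some of these, which form
the multiset `w`, pass through the critical points of a slice; the others enclose the term. -/
structure BoxedBy (X : ℕ → ℕ) (t : ℕ) (w : Multiset Slice) (r r' : Result) : Prop where
  card_le : w.card ≤ t
  cpts_eq : r'.cpts = r.cpts
  ty_inst : r'.ty.inst X = Ty.bang^[t] (r.ty.inst X)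
  base_eq : ∃ f : Entry → Entry, r'.base = r.base.map f ∧ ∀ e, (f e).var = e.var ∧
    (f e).occ = e.occ ∧ (f e).ty.inst X = Ty.bang^[t - occCount w e.occ] (e.ty.inst X)
  rows_name : r'.rows.map Row.name = r.rows.map Row.name
  rowsSat : ∀ f, RowsSat X f r'.rows → RowsSat X (f + rowCount w) r.rows

namespace BoxedBy

variable {X : ℕ → ℕ} {t t' : ℕ} {w w' : Multiset Slice} {r r' r'' : Result}

theorem refl (X : ℕ → ℕ) (r : Result) : BoxedBy X 0 0 r r where
  card_le := le_rfl
  cpts_eq := rfl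
  ty_inst := rfl
  base_eq := ⟨id, (List.map_id _).symm, fun _ => ⟨rfl, rfl, by rw [Nat.zero_sub]; rfl⟩⟩
  rows_name := rfl
  rowsSat _ h := h

theorem trans (h : BoxedBy X t w r r') (h' : BoxedBy X t' w' r' r'') :
    BoxedBy X (t' + t) (w' + w) r r'' where
  card_le := by
    rw [Multiset.card_add]
    exact Nat.add_le_add h'.card_le h.card_le
  cpts_eq := h'.cpts_eq.trans h.cpts_eq
  ty_inst := by rw [h'.ty_inst, h.ty_inst, Function.iterate_add_apply]
  base_eq := by
    obtain ⟨f, hf, hbase⟩ := h.base_eq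
    obtain ⟨f', hf', hbase'⟩ := h'.base_eq
    refine ⟨f' ∘ f, by rw [hf', hf, List.map_map], fun e => ?_⟩
    obtain ⟨hvar, hocc, hinst⟩ := hbase e
    obtain ⟨hvar', hocc', hinst'⟩ := hbase' (f e)
    refine ⟨hvar'.trans hvar, hocc'.trans hocc, ?_⟩
    have := (occCount_le_card w e.occ).trans h.card_le
    have := (occCount_le_card w' e.occ).trans h'.card_le
    rw [Function.comp_apply, hinst', hinst, hocc, ← Function.iterate_add_apply, occCount_add,
      Pi.add_apply]
    congr 1
    omega
  rows_name := h'.rows_name.trans h.rows_name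
  rowsSat f hf := by
    rw [rowCount_add, ← add_assoc]
    exact h.rowsSat _ (h'.rowsSat f hf)

theorem slice (X : ℕ → ℕ) (c : ℕ) (sl : Slice) (Γ : GTy) (B : List Entry) (A : List Row)
    (C : List Slice) :
    BoxedBy X (X c) (.replicate (X c) sl) ⟨Γ, B, A, C⟩
      ⟨Γ.bang c, B.map fun e => if sl.hasOcc e.occ then e else { e with ty := e.ty.bang c },
        A.map fun q => if sl.hasRow q.name then { q with constr := q.constr.sub c } else q, C⟩ where
  card_le := (Multiset.card_replicate _ _).le
  cpts_eq := rfl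
  ty_inst := Γ.inst_bang X c
  base_eq := ⟨_, rfl, fun e => by
    rw [occCount_replicate]
    split_ifs <;> simp [GTy.inst_bang]⟩
  rows_name := by
    rw [List.map_map]
    refine List.map_congr_left fun q _ => ?_
    simp only [Function.comp_apply]
    split_ifs <;> rfl
  rowsSat f hf q hq := by
    have := hf _ (List.mem_map_of_mem hq)
    rw [Pi.add_apply, rowCount_replicate]
    split_ifs at this ⊢
    exacts [Constr.satSub_sub.1 this, this]

theorem enclose (X : ℕ → ℕ) (b : ℕ) (Γ : GTy) (B : List Entry) (A : List Row) (C : List Slice) :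
    BoxedBy X (X b) 0 ⟨Γ, B, A, C⟩
      ⟨Γ.bang b, B.map fun e => { e with ty := e.ty.bang b }, A, C⟩ where
  card_le := Nat.zero_le _
  cpts_eq := rfl
  ty_inst := Γ.inst_bang X b
  base_eq := ⟨_, rfl, fun e => ⟨rfl, rfl, e.ty.inst_bang X b⟩⟩
  rows_name := rfl
  rowsSat _ h := h

theorem fvo_eq (h : BoxedBy X t w r r') : fvo r'.base = fvo r.base := by
  obtain ⟨f, hf, hbase⟩ := h.base_eq
  rw [hf, fvo, List.map_map]
  exact List.map_congr_left fun e _ => (hbase e).2.1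

theorem synthShape {M : Lam} {n m m' : ℕ} {D : Skel} (h : BoxedBy X t w r r')
    (hs : SynthShape M n m r D) (hm : m ≤ m') : SynthShape M n m' r' D where
  le := hs.le.trans hm
  fv_eq := h.fvo_eq ▸ hs.fv_eq
  nodup := h.fvo_eq ▸ hs.nodup
  leaves y hy := Set.Ico_subset_Ico_right hm (hs.leaves y hy)
  linear := hs.linear
  toLam_eq ρ hρ := by
    obtain ⟨f, hf, hbase⟩ := h.base_eq
    refine hs.toLam_eq ρ fun e he => ?_
    rw [← (hbase e).1, ← (hbase e).2.1]
    exact hρ _ (hf ▸ List.mem_map_of_mem he)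
  rows q hq := by
    obtain ⟨q', hq', hname⟩ := List.mem_map.1 (h.rows_name ▸ List.mem_map_of_mem hq)
    exact hname ▸ hs.rows_mono hm q' hq'
  cpts := by
    rw [h.cpts_eq]
    exact hs.cpts_mono hm

theorem envFits {f : ℕ → ℕ} {a : ℕ} {Γ : Env} (h : BoxedBy X t w r r')
    (hΓ : EnvFits X f a r'.base Γ) : EnvFits X (f + occCount w) (a + t) r.base Γ := by
  obtain ⟨g, hg, hbase⟩ := h.base_eq
  intro e he
  obtain ⟨-, hocc, hinst⟩ := hbase e
  obtain ⟨hle, hty⟩ := hΓ (g e) (hg ▸ List.mem_map_of_mem he)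
  have := (occCount_le_card w e.occ).trans h.card_le
  rw [hocc] at hle hty
  rw [Pi.add_apply, hty, hinst, ← Function.iterate_add_apply]
  refine ⟨by omega, ?_⟩
  congr 1
  omega

theorem synthTyped {D : Skel} (h : BoxedBy X t w r r') (hw : ∀ sl ∈ w, sl ∈ r.cpts)
    (hD : D.length ≠ 0) (ht : SynthTyped X r D.Typed) : SynthTyped X r' D.BoxTyped := by
  intro v hv hrows a Γ ha hΓ
  have hmem : ∀ sl ∈ v + w, sl ∈ r.cpts := fun sl hsl =>
    (Multiset.mem_add.1 hsl).elim (fun hsl => h.cpts_eq ▸ hv sl hsl) (hw sl)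
  have hcard : (v + w).card ≤ a + t := by
    rw [Multiset.card_add]
    exact Nat.add_le_add ha h.card_le
  refine ⟨a + t, r.ty.inst X, ht (v + w) hmem ?_ (a + t) Γ hcard ?_, ?_, fun h => absurd h hD⟩
  · rw [rowCount_add]
    exact h.rowsSat _ hrows
  · rw [occCount_add]
    exact h.envFits hΓ
  · rw [h.ty_inst, Function.iterate_add_apply]

end BoxedBy

theorem boxSlices_spec (X : ℕ → ℕ) {S C : List Slice} {B B' : List Entry} {Γ Γ' : GTy}
    {A A' : List Row} {n m : ℕ} (h : boxSlices S B Γ A n = some ((B', Γ', A'), m)) :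
    n ≤ m ∧ ∃ t w, (∀ sl ∈ w, sl ∈ S) ∧ BoxedBy X t w ⟨Γ, B, A, C⟩ ⟨Γ', B', A', C⟩ := by
  induction S generalizing B Γ A n with
  | nil =>
    simp only [boxSlices, Fresh.pure_eq_some, Prod.mk.injEq] at h
    obtain ⟨⟨rfl, rfl, rfl⟩, rfl⟩ := h
    exact ⟨le_rfl, 0, 0, nofun, .refl X _⟩
  | cons sl S ih =>
    simp only [boxSlices, Fresh.bind_eq_some, fresh_eq_some] at h
    obtain ⟨c, _, ⟨rfl, rfl⟩, h⟩ := h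
    obtain ⟨hle, t, w, hw, hbox⟩ := ih h
    refine ⟨n.le_succ.trans hle, _, _, fun s hs => ?_, (BoxedBy.slice X n sl Γ B A C).trans hbox⟩
    rcases Multiset.mem_add.1 hs with hs | hs
    · exact List.mem_cons_of_mem _ (hw s hs)
    · rw [Multiset.eq_of_mem_replicate hs]
      exact List.mem_cons_self

theorem boxing_spec {X : ℕ → ℕ} {M : Lam} {n m k : ℕ} {r r' : Result} {D : Skel}
    (hs : SynthShape M n m r D) (ht : SynthTyped X r D.Typed) (h : boxing M r m = some (r', k)) :
    SynthShape M n k r' D ∧ SynthTyped X r' D.BoxTyped := by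
  cases hM : M.isVar with
  | true =>
    simp only [boxing, hM, if_true, Fresh.pure_eq_some] at h
    obtain ⟨rfl, rfl⟩ := h
    exact ⟨hs, ht.boxTyped⟩
  | false =>
    simp only [boxing, hM, Bool.false_eq_true, if_false, Fresh.bind_eq_some, Fresh.pure_eq_some,
      fresh_eq_some] at h
    obtain ⟨⟨B, Γ, A⟩, b, h, _, _, ⟨rfl, rfl⟩, rfl, rfl⟩ := h
    obtain ⟨hle, t, w, hw, hbox⟩ := boxSlices_spec X (C := r.cpts) h
    have hbox := hbox.trans (.enclose X b Γ B A r.cpts)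
    have hD : D.length ≠ 0 := by
      rw [hs.length_eq]
      cases M <;> simp_all [Lam.isVar, Lam.length]
    exact ⟨hbox.synthShape hs (Nat.le_succ_of_le hle), hbox.synthTyped (by simpa using hw) hD ht⟩

/-! ### Abstractions -/

/-- The base obtained from `B` by abstracting the variable `0`. -/
def unbind (B : List Entry) : List Entry :=
  (B.filter fun e => e.var != 0).map fun e => { e with var := e.var - 1 }

/-- The occurrences of the variable `0` in the base `B`. -/
def boundOccs (B : List Entry) : Finset ℕ := (fvo (B.filter fun e => e.var == 0)).toFinset

section Unbind

variable {B : List Entry}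

theorem mem_boundOccs {y : ℕ} : y ∈ boundOccs B ↔ ∃ e ∈ B, e.var = 0 ∧ e.occ = y := by
  simp only [boundOccs, fvo, List.mem_toFinset, List.mem_map, List.mem_filter, beq_iff_eq,
    and_assoc]

theorem occ_mem_boundOccs (hB : (fvo B).Nodup) {e : Entry} (he : e ∈ B) :
    e.occ ∈ boundOccs B ↔ e.var = 0 := by
  refine mem_boundOccs.trans ⟨?_, fun hvar => ⟨e, he, hvar, rfl⟩⟩
  rintro ⟨e', he', hvar, hocc⟩
  exact eq_of_occ_eq hB he' he hocc ▸ hvar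

theorem mem_unbind {e : Entry} (he : e ∈ B) (hvar : e.var ≠ 0) :
    { e with var := e.var - 1 } ∈ unbind B :=
  List.mem_map.2 ⟨e, List.mem_filter.2 ⟨he, bne_iff_ne.2 hvar⟩, rfl⟩

theorem fvo_unbind (B : List Entry) : fvo (unbind B) = fvo (B.filter fun e => e.var != 0) :=
  List.map_map

theorem fvo_unbind_subset (B : List Entry) : fvo (unbind B) ⊆ fvo B :=
  fvo_unbind B ▸ (List.filter_sublist.map _).subset

theorem nodup_fvo_unbind (hB : (fvo B).Nodup) : (fvo (unbind B)).Nodup :=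
  fvo_unbind B ▸ hB.sublist (List.filter_sublist.map _)

theorem toFinset_fvo_unbind (hB : (fvo B).Nodup) :
    (fvo (unbind B)).toFinset = (fvo B).toFinset \ boundOccs B := by
  ext y
  rw [fvo_unbind]
  simp only [fvo, List.mem_toFinset, List.mem_map, List.mem_filter, bne_iff_ne,
    Finset.mem_sdiff]
  constructor
  · rintro ⟨e, ⟨he, hvar⟩, rfl⟩
    exact ⟨⟨e, he, rfl⟩, fun h => hvar ((occ_mem_boundOccs hB he).1 h)⟩
  · rintro ⟨⟨e, he, rfl⟩, h⟩
    exact ⟨e, ⟨he, fun hvar => h ((occ_mem_boundOccs hB he).2 hvar)⟩, rfl⟩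

theorem EnvFits.of_unbind {X f : ℕ → ℕ} {a : ℕ} {Γ : Env} {T : Ty} (hB : (fvo B).Nodup)
    (hΓ : EnvFits X f a (unbind B) Γ)
    (hbound : ∀ e ∈ B, e.var = 0 → f e.occ = 0 ∧ e.ty.inst X = T) :
    EnvFits X f a B ((boundOccs B).piecewise (fun _ => ⟨a, T⟩) Γ) := by
  intro e he
  by_cases hvar : e.var = 0
  · obtain ⟨hf, rfl⟩ := hbound e he hvar
    rw [Finset.piecewise_eq_of_mem _ _ _ ((occ_mem_boundOccs hB he).2 hvar), hf, add_zero,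
      Nat.sub_self]
    exact ⟨le_rfl, rfl⟩
  · rw [Finset.piecewise_eq_of_notMem _ _ _ fun h => hvar ((occ_mem_boundOccs hB he).1 h)]
    exact hΓ { e with var := e.var - 1 } (mem_unbind he hvar)

end Unbind

section Lam

variable {X : ℕ → ℕ} {M : Lam} {n m : ℕ} {r : Result} {D : Skel}

theorem SynthShape.lam {m' : ℕ} {T : GTy} {R : List Row} {C : List Slice}
    (h : SynthShape M n m r D) (hm : m ≤ m') (hR : ∀ q ∈ R, q.name ∈ Set.Ico m m')
    (hC : ∀ sl ∈ C, sl.In (Set.Ico n m') (Set.Ico n m')) :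
    SynthShape (.lam M) n m' ⟨T, unbind r.base, r.rows ++ R, C⟩ (.lam (boundOccs r.base) D) where
  le := h.le.trans hm
  fv_eq := by rw [toFinset_fvo_unbind h.nodup, ← h.fv_eq, Skel.fv]
  nodup := nodup_fvo_unbind h.nodup
  leaves y hy := Set.Ico_subset_Ico_right hm (h.leaves y hy)
  linear := by
    refine ⟨fun y hy => ?_, h.linear⟩
    obtain ⟨e, he, -, rfl⟩ := mem_boundOccs.1 hy
    exact h.mem_fv.2 (List.mem_map_of_mem he)
  toLam_eq ρ hρ := by
    rw [Skel.toLam, ← h.toLam_eq ((boundOccs r.base).piecewise (fun _ => 0) fun y => ρ y + 1)]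
    · congr 2
      funext y
      by_cases hy : y ∈ boundOccs r.base <;> simp [hy, Lam.rename]
    · intro e he
      by_cases hvar : e.var = 0
      · rw [Finset.piecewise_eq_of_mem _ _ _ ((occ_mem_boundOccs h.nodup he).2 hvar), hvar]
      · rw [Finset.piecewise_eq_of_notMem _ _ _ fun hy =>
            hvar ((occ_mem_boundOccs h.nodup he).1 hy), hρ _ (mem_unbind he hvar),
          Nat.sub_add_cancel (Nat.pos_of_ne_zero hvar)]
  rows := List.forall_mem_append.2 ⟨h.rows_mono hm, fun q hq =>
    Set.Ico_subset_Ico_left h.le (hR q hq)⟩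
  cpts := hC

theorem SynthShape.level_le_of_unbind (h : SynthShape M n m r D) {f : ℕ → ℕ} {a : ℕ} {Γ : Env}
    (hΓ : EnvFits X f a (unbind r.base) Γ) : ∀ y ∈ D.fv \ boundOccs r.base, (Γ y).level ≤ a := by
  intro y hy
  rw [h.fv_eq, ← toFinset_fvo_unbind h.nodup, List.mem_toFinset] at hy
  exact hΓ.level_le y hy

theorem SynthTyped.lam_contract {m' : ℕ} {A : List Constr} {R : List Row} {e₀ : Entry}
    (hs : SynthShape M n m r D) (ht : SynthTyped X r D.BoxTyped)
    (hA : contract ((r.base.filter fun e => e.var == 0).map Entry.ty) = some A)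
    (hR : nameRows A m = some (R, m')) (he₀ : e₀ ∈ r.base) (hvar₀ : e₀.var = 0) :
    SynthTyped X ⟨.arr [] e₀.ty r.ty, unbind r.base, r.rows ++ R, r.cpts.filter fun sl =>
        !((r.base.filter fun e => e.var == 0).any fun e => sl.hasOcc e.occ)⟩
      (Skel.lam (boundOccs r.base) D).Typed := by
  obtain ⟨-, rfl, hname⟩ := nameRows_spec hR
  intro w hw hrows a Γ ha hΓ
  have hmem : ∀ sl ∈ w, sl ∈ r.cpts := fun sl hsl => List.mem_of_mem_filter (hw sl hsl)
  have hocc : ∀ e ∈ r.base, e.var = 0 → occCount w e.occ = 0 := fun e he hvar =>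
    Multiset.countP_eq_zero.2 fun sl hsl hsl' => by
      have hdisc := List.any_eq_false.1 (Bool.not_eq_true' _ ▸ List.of_mem_filter (hw sl hsl))
      exact hdisc e (List.mem_filter.2 ⟨he, beq_iff_eq.2 hvar⟩) hsl'
  obtain ⟨hrows, hrowsR⟩ := List.forall_mem_append.1 hrows
  have hsol : IsSolution X (R.map Row.constr) := RowsSat.isSolution hrowsR fun q hq =>
    rowCount_eq_zero (fun sl hsl => hs.cpts sl (hmem sl hsl)) fun h =>
      absurd h.2 (hname q hq).1.not_gt
  refine ⟨hs.level_le_of_unbind hΓ, _, _, rfl, fun hcard => ?_, ht w hmem hrows a _ ha ?_⟩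
  · obtain ⟨y, hy, hne⟩ := Finset.exists_mem_ne hcard e₀.occ
    obtain ⟨e, he, hvar, rfl⟩ := mem_boundOccs.1 hy
    exact (contract_filter_inst hA hsol he₀ hvar₀ he hvar).2 fun h => hne (h ▸ rfl)
  · exact hΓ.of_unbind hs.nodup fun e he hvar =>
      ⟨hocc e he hvar, (contract_filter_inst hA hsol he hvar he₀ hvar₀).1⟩

theorem SynthTyped.lam_of_not_mem {j : ℕ} {b : Bool} {Θ Δ : GTy} {R : List Row}
    (hs : SynthShape M n m r D) (ht : SynthTyped X r D.BoxTyped) (hB : ∀ e ∈ r.base, e.var ≠ 0)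
    (hj : j ∉ Set.Ico n m)
    (hΔ : ∀ w : Multiset Slice, (∀ sl ∈ w, sl ∈ addCpt b j (fvo r.base) r.cpts) →
      RowsSat X (rowCount w) R → r.ty.inst X = Ty.bang^[rowCount w j] (Δ.inst X)) :
    SynthTyped X ⟨.arr [] Θ Δ, unbind r.base, r.rows ++ R, addCpt b j (fvo (unbind r.base)) r.cpts⟩
      (Skel.lam (boundOccs r.base) D).Typed := by
  have hfvo : fvo (unbind r.base) = fvo r.base := by
    rw [fvo_unbind, List.filter_eq_self.2 fun e he => bne_iff_ne.2 (hB e he)]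
  have hbound : boundOccs r.base = ∅ := Finset.eq_empty_of_forall_notMem fun y hy =>
    let ⟨e, he, hvar, _⟩ := mem_boundOccs.1 hy
    hB e he hvar
  intro w hw hrows a Γ ha hΓ
  dsimp only at hw
  rw [hfvo] at hw
  obtain ⟨hrows, hrowsR⟩ := List.forall_mem_append.1 hrows
  refine ⟨hs.level_le_of_unbind hΓ, _, _, rfl, fun hcard => ?_, ?_⟩
  · simp [hbound] at hcard
  · exact ht.boxTyped_of_addCpt hs hj hw hrows ha
      (hΓ.of_unbind hs.nodup fun e he hvar => absurd hvar (hB e he)) (hΔ w hw hrowsR)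

theorem synthSound_lam_of_isApp {l : ℕ} {Θ : GTy} (hs : SynthShape M n m r D)
    (ht : SynthTyped X r D.BoxTyped) (hB : ∀ e ∈ r.base, e.var ≠ 0) (hml : m ≤ l) :
    SynthSound X (.lam M) n (l + 2)
      ⟨.arr [] Θ (r.ty.setExpo l), unbind r.base, r.rows ++ [⟨l + 1, .eqZero r.ty.expo [l]⟩],
        r.cpts ++ [[(l + 1, fvo (unbind r.base))]]⟩ := by
  have := hs.le
  have hname : l + 1 ∈ Set.Ico m (l + 2) := ⟨by omega, by omega⟩
  refine ⟨.lam (boundOccs r.base) D,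
    hs.lam (by omega) (List.forall_mem_singleton.2 hname) (addCpt_in (b := true)
      (hs.cpts_mono (by omega)) (Set.Ico_subset_Ico_left hs.le hname) fun y hy =>
        Set.Ico_subset_Ico_right (by omega) (hs.occ_mem y (fvo_unbind_subset _ hy))),
    ht.lam_of_not_mem (b := true) hs hB (fun hj => ?_) fun w _ hR => ?_⟩
  · exact hj.2.not_gt (by omega)
  · exact GTy.inst_eq_setExpo (by simpa [RowsSat, Constr.SatSub, Expo.eval] using hR)

theorem synthSound_lam_of_not_isApp {l : ℕ} {Θ : GTy} (hs : SynthShape M n m r D)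
    (ht : SynthTyped X r D.BoxTyped) (hB : ∀ e ∈ r.base, e.var ≠ 0) (hml : m ≤ l) :
    SynthSound X (.lam M) n l ⟨.arr [] Θ r.ty, unbind r.base, r.rows, r.cpts⟩ := by
  have hm : m ∉ Set.Ico n m := fun h => h.2.false
  rw [← List.append_nil r.rows]
  refine ⟨.lam (boundOccs r.base) D, hs.lam hml nofun (hs.cpts_mono hml),
    ht.lam_of_not_mem (b := false) hs hB hm fun w hw _ => ?_⟩
  rw [rowCount_eq_zero (fun sl hsl => hs.cpts sl (hw sl hsl)) hm]
  rfl

theorem synthLam_spec {m' : ℕ} {r' : Result} {σ : STy} (hs : SynthShape M n m r D)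
    (ht : SynthTyped X r D.Typed) (h : synthLam σ M r m = some (r', m')) :
    SynthSound X (.lam M) n m' r' := by
  simp only [synthLam, Fresh.bind_eq_some] at h
  obtain ⟨⟨Γ, B, A, C⟩, k, hbox, h⟩ := h
  obtain ⟨hs, ht⟩ := boxing_spec hs ht hbox
  cases hBx : B.filter fun e => e.var == 0 with
  | cons e₀ es =>
    simp only [hBx, Fresh.bind_eq_some, Fresh.pure_eq_some, Fresh.lift_eq_some] at h
    obtain ⟨A₃, _, ⟨hA₃, rfl⟩, R, _, hR, rfl, rfl⟩ := h
    rw [← hBx] at hA₃ ⊢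
    obtain ⟨he₀, hvar₀⟩ := List.mem_filter.1 (hBx ▸ List.mem_cons_self : e₀ ∈ B.filter _)
    obtain ⟨hle, -, hname⟩ := nameRows_spec hR
    exact ⟨.lam (boundOccs B) D,
      hs.lam hle hname fun sl hsl => hs.cpts_mono hle sl (List.mem_of_mem_filter hsl),
      ht.lam_contract hs hA₃ hR he₀ (beq_iff_eq.1 hvar₀)⟩
  | nil =>
    have hB : ∀ e ∈ B, e.var ≠ 0 := fun e he => by
      simpa using List.filter_eq_nil_iff.1 hBx e he
    simp only [hBx, Fresh.bind_eq_some] at h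
    obtain ⟨Θ, l, hΘ, h⟩ := h
    cases hM : M.isApp with
    | true =>
      simp only [hM, if_true, Fresh.bind_eq_some, Fresh.pure_eq_some, fresh_eq_some] at h
      obtain ⟨_, _, ⟨rfl, rfl⟩, _, _, ⟨rfl, rfl⟩, rfl, rfl⟩ := h
      exact synthSound_lam_of_isApp hs ht hB (process_lt hΘ).le
    | false =>
      simp only [hM, Bool.false_eq_true, if_false, Fresh.pure_eq_some] at h
      obtain ⟨rfl, rfl⟩ := h
      exact synthSound_lam_of_not_isApp hs ht hB (process_lt hΘ).le

end Lam

/-! ### Applications -/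

theorem unify_nameRows_spec {Θ Δ : GTy} {A : List Constr} {R : List Row} {n m : ℕ}
    (hA : unify Θ Δ = some A) (hR : nameRows A n = some (R, m)) :
    n < m ∧ (∀ q ∈ R, q.name ∈ Set.Ico n m) ∧ (∃ c, R.take 1 = [⟨n, c⟩]) ∧
      ∀ X f, RowsSat X f R → (∀ j ∈ Set.Ioo n m, f j = 0) →
        Θ.inst X = Ty.bang^[f n] (Δ.inst X) := by
  obtain ⟨A, rfl, hinst⟩ := unify_spec hA
  have hname := (nameRows_spec hR).2.2
  simp only [nameRows, Fresh.bind_eq_some, Fresh.pure_eq_some, fresh_eq_some] at hR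
  obtain ⟨_, _, ⟨rfl, rfl⟩, R, _, hR, rfl, rfl⟩ := hR
  obtain ⟨hle, rfl, hname'⟩ := nameRows_spec hR
  refine ⟨hle, hname, ⟨_, rfl⟩, fun X f hrows hf => ?_⟩
  obtain ⟨hexpo, hrows⟩ := List.forall_mem_cons.1 hrows
  exact hinst X _ hexpo (RowsSat.isSolution hrows fun q hq => hf q.name (hname' q hq))

theorem fvo_append (B B' : List Entry) : fvo (B ++ B') = fvo B ++ fvo B' :=
  List.map_append

theorem SynthTyped.boxTyped_of_restricts {X : ℕ → ℕ} {M : Lam} {n m j a : ℕ} {b : Bool}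
    {r : Result} {D : Skel} {I : Set ℕ} {w w' : Multiset Slice} {Γ : Env} {T : Ty}
    (ht : SynthTyped X r D.BoxTyped) (hs : SynthShape M n m r D) (hj : j ∉ Set.Ico n m)
    (hw : Restricts I (Set.Ico n m) (addCpt b j (fvo r.base) r.cpts) w w')
    (hI : Set.Ico n m ⊆ I) (hjI : j ∈ I) (hrows : RowsSat X (rowCount w) r.rows)
    (ha : w.card ≤ a) (hΓ : EnvFits X (occCount w) a r.base Γ)
    (hT : r.ty.inst X = Ty.bang^[rowCount w j] T) : D.BoxTyped a Γ T :=
  ht.boxTyped_of_addCpt hs hj hw.mem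
    (hrows.congr fun q hq => (hw.rowCount_eq _ (hI (hs.rows q hq))).symm) (hw.card_le.trans ha)
    (hΓ.congr fun y hy => (hw.occCount_eq y (hs.occ_mem y hy)).symm) (hw.rowCount_eq j hjI ▸ hT)

section App

variable {X : ℕ → ℕ} {M N : Lam} {n m k j : ℕ} {b₁ b₂ : Bool} {r₁ r₂ : Result} {D E : Skel}
  {ns : Expo} {Θ Δ : GTy} {R : List Row}

theorem SynthShape.app {c : Constr} (h₁ : SynthShape M n m r₁ D) (h₂ : SynthShape N m k r₂ E)
    (hkj : k ≤ j) (hR : ∀ q ∈ R, q.name ∈ Set.Ico k j) :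
    SynthShape (.app M N) n (j + 1)
      ⟨Δ, r₁.base ++ r₂.base, r₁.rows ++ r₂.rows ++ R ++ [⟨j, c⟩],
        prodUnion (addCpt b₁ j (fvo r₁.base) r₁.cpts) (addCpt b₂ k (fvo r₂.base) r₂.cpts)⟩
      (.app D E) := by
  have hnm := h₁.le
  have hmk := h₂.le
  have hsub₁ : Set.Ico n m ⊆ Set.Ico n (j + 1) := Set.Ico_subset_Ico_right (by omega)
  have hsub₂ : Set.Ico m k ⊆ Set.Ico n (j + 1) := Set.Ico_subset_Ico hnm (by omega)
  have hdisj : Disjoint (Set.Ico n m) (Set.Ico m k) := Set.Ico_disjoint_Ico_same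
  exact
  { le := by omega
    fv_eq := by rw [fvo_append, List.toFinset_append, ← h₁.fv_eq, ← h₂.fv_eq, Skel.fv]
    nodup := fvo_append _ _ ▸ h₁.nodup.append h₂.nodup fun y hy hy' =>
      hdisj.notMem_of_mem_left (h₁.occ_mem y hy) (h₂.occ_mem y hy')
    leaves := fun y hy => (Finset.mem_union.1 hy).elim (fun hy => hsub₁ (h₁.leaves y hy))
      fun hy => hsub₂ (h₂.leaves y hy)
    linear := ⟨Finset.disjoint_left.2 fun y hy hy' =>
      hdisj.notMem_of_mem_left (h₁.leaves y hy) (h₂.leaves y hy'), h₁.linear, h₂.linear⟩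
    toLam_eq := fun ρ hρ => by
      obtain ⟨hρ₁, hρ₂⟩ := List.forall_mem_append.1 hρ
      rw [Skel.toLam, h₁.toLam_eq ρ hρ₁, h₂.toLam_eq ρ hρ₂]
    rows := by
      simp only [List.forall_mem_append, List.mem_singleton, forall_eq]
      exact ⟨⟨⟨fun q hq => hsub₁ (h₁.rows q hq), fun q hq => hsub₂ (h₂.rows q hq)⟩, fun q hq =>
        Set.Ico_subset_Ico (hnm.trans hmk) j.le_succ (hR q hq)⟩, by omega, j.lt_succ_self⟩
    cpts := prodUnion_in
      (fun sl hsl => (h₁.addCpt_in sl hsl).mono (Set.insert_subset ⟨by omega, by omega⟩ hsub₁)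
        hsub₁)
      (fun sl hsl => (h₂.addCpt_in sl hsl).mono (Set.insert_subset ⟨by omega, by omega⟩ hsub₂)
        hsub₂) }

theorem SynthTyped.app (hs₁ : SynthShape M n m r₁ D) (ht₁ : SynthTyped X r₁ D.BoxTyped)
    (hs₂ : SynthShape N m k r₂ E) (ht₂ : SynthTyped X r₂ E.BoxTyped) (hkj : k < j)
    (hty : r₁.ty = .arr ns Θ Δ)
    (hunify : ∀ f, RowsSat X f R → (∀ i ∈ Set.Ioo k j, f i = 0) → (b₂ = false → f k = 0) →
      r₂.ty.inst X = Ty.bang^[f k] (Θ.inst X)) :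
    SynthTyped X
      ⟨Δ, r₁.base ++ r₂.base, r₁.rows ++ r₂.rows ++ R ++ [⟨j, .eqZero ns []⟩],
        prodUnion (addCpt b₁ j (fvo r₁.base) r₁.cpts) (addCpt b₂ k (fvo r₂.base) r₂.cpts)⟩
      (Skel.app D E).Typed := by
  intro w hw hrows a Γ ha hΓ
  simp only [RowsSat, List.forall_mem_append, List.mem_singleton, forall_eq] at hrows
  obtain ⟨⟨⟨hrows₁, hrows₂⟩, hrowsR⟩, hrow⟩ := hrows
  obtain ⟨hΓ₁, hΓ₂⟩ := List.forall_mem_append.1 hΓ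
  have hmk := hs₂.le
  have hI : Disjoint (insert j (Set.Ico n m)) (Set.Ico m j) :=
    Set.disjoint_insert_left.2 ⟨fun hj => hj.2.false, Set.Ico_disjoint_Ico_same⟩
  have hJ : Disjoint (Set.Ico n m) (Set.Ico m k) := Set.Ico_disjoint_Ico_same
  have hsub : insert k (Set.Ico m k) ⊆ Set.Ico m j :=
    Set.insert_subset ⟨hmk, hkj⟩ (Set.Ico_subset_Ico_right hkj.le)
  obtain ⟨w₁, hw₁⟩ := exists_restricts_left_of_prodUnion hw
    (fun sl hsl => (hs₂.addCpt_in sl hsl).mono hsub subset_rfl) hI hJ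
  obtain ⟨w₂, hw₂⟩ := exists_restricts_right_of_prodUnion hw hs₁.addCpt_in hI hJ
  have hnew : ∀ i ∈ Set.Ioo k j, rowCount w i = 0 := fun i hi => by
    rw [← hw₂.rowCount_eq i ⟨hmk.trans hi.1.le, hi.2⟩]
    exact rowCount_eq_zero (fun sl hsl => hs₂.addCpt_in sl (hw₂.mem sl hsl)) fun h =>
      h.elim hi.1.ne' fun h => h.2.not_gt hi.1
  have hcrit : b₂ = false → rowCount w k = 0 := by
    rintro rfl
    rw [← hw₂.rowCount_eq k ⟨hmk, hkj⟩]
    exact rowCount_eq_zero (fun sl hsl => hs₂.cpts sl (hw₂.mem sl hsl)) fun h => h.2.false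
  refine ⟨fun y hy => ?_, Θ.inst X, ?_, ?_⟩
  · rw [hs₁.fv_eq, hs₂.fv_eq, ← List.toFinset_append, ← fvo_append, List.mem_toFinset] at hy
    exact hΓ.level_le y hy
  · refine ht₁.boxTyped_of_restricts hs₁ (fun hj => hj.2.not_gt (hmk.trans_lt hkj)) hw₁
      (Set.subset_insert j _) (Set.mem_insert j _) hrows₁ ha hΓ₁ ?_
    have hns : Expo.eval X ns = rowCount w j := hrow.trans (Nat.zero_add _)
    rw [hty, GTy.inst, hns]
  · exact ht₂.boxTyped_of_restricts hs₂ (fun hk => hk.2.false) hw₂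
      ((Set.subset_insert k _).trans hsub) ⟨hmk, hkj⟩ hrows₂ ha hΓ₂
      (hunify _ hrowsR hnew hcrit)

theorem synthApp_spec {l : ℕ} {r : Result} (hs₁ : SynthShape M n m r₁ D)
    (ht₁ : SynthTyped X r₁ D.Typed) (hs₂ : SynthShape N m k r₂ E) (ht₂ : SynthTyped X r₂ E.Typed)
    (h : synthApp M N r₁ r₂ k = some (r, l)) :
    SynthSound X (.app M N) n l r := by
  obtain ⟨Θ₁ | ⟨ns, Θ, Δ⟩, B₁, A₁, C₁⟩ := r₁
  · exact absurd h nofun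
  simp only [synthApp, Fresh.bind_eq_some] at h
  obtain ⟨⟨Γ, B₂, A₂, C₂⟩, k, hbox, h⟩ := h
  obtain ⟨hs₂, ht₂⟩ := boxing_spec hs₂ ht₂ hbox
  refine ⟨.app D E, ?_⟩
  cases hN : N.isApp with
  | true =>
    simp only [hN, if_true, Fresh.bind_eq_some, Fresh.lift_eq_some, Fresh.pure_eq_some,
      fresh_eq_some] at h
    obtain ⟨A₄, _, ⟨hA₄, rfl⟩, R, j, hR, _, _, ⟨rfl, rfl⟩, rfl, rfl⟩ := h
    obtain ⟨hlt, hname, ⟨c, hc⟩, hinst⟩ := unify_nameRows_spec hA₄ hR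
    rw [hc]
    exact ⟨hs₁.app (b₁ := M.isApp) (b₂ := true) hs₂ hlt.le hname,
      ht₁.boxTyped.app (b₁ := M.isApp) (b₂ := true) hs₁ hs₂ ht₂ hlt rfl fun f hf hnew _ =>
        hinst X f hf hnew⟩
  | false =>
    simp only [hN, Bool.false_eq_true, if_false, Fresh.bind_eq_some, Fresh.lift_eq_some,
      Fresh.pure_eq_some, fresh_eq_some] at h
    obtain ⟨A₄, _, ⟨hA₄, rfl⟩, R, j, hR, _, _, ⟨rfl, rfl⟩, rfl, rfl⟩ := h
    obtain ⟨hlt, hname, -, hinst⟩ := unify_nameRows_spec hA₄ hR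
    refine ⟨hs₁.app (b₁ := M.isApp) (b₂ := false) hs₂ hlt.le hname,
      ht₁.boxTyped.app (b₁ := M.isApp) (b₂ := false) hs₁ hs₂ ht₂ hlt rfl fun f hf hnew hk => ?_⟩
    have h := hinst X f hf hnew
    rw [hk rfl] at h ⊢
    exact h.symm

end App

/-! ### Soundness -/

theorem synthVar_spec (X : ℕ → ℕ) {i : ℕ} {σ : STy} {n m : ℕ} {r : Result}
    (h : synthVar i σ n = some (r, m)) :
    SynthSound X (.var i) n m r := by
  simp only [synthVar, Fresh.bind_eq_some, Fresh.pure_eq_some, fresh_eq_some] at h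
  obtain ⟨Θ, y, hΘ, _, _, ⟨rfl, rfl⟩, rfl, rfl⟩ := h
  have hny := process_lt hΘ
  have hmem : y ∈ Set.Ico n (y + 1) := ⟨hny.le, y.lt_succ_self⟩
  refine ⟨.leaf y, ?_, fun w hw _ a Γ _ hΓ => ?_⟩
  · exact
    { le := by omega
      fv_eq := rfl
      nodup := List.nodup_singleton y
      leaves := fun z hz => Finset.mem_singleton.1 hz ▸ hmem
      linear := trivial
      toLam_eq := fun ρ hρ => congrArg Lam.var (hρ _ List.mem_cons_self)
      rows := nofun
      cpts := nofun }
  · obtain rfl : w = 0 := Multiset.eq_zero_of_forall_notMem fun sl hsl => nomatch hw sl hsl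
    exact hΓ _ List.mem_cons_self

theorem synth_spec (X : ℕ → ℕ) {Γ : List STy} {M : Lam} {σ : STy} (d : SDer Γ M σ) {n m : ℕ}
    {r : Result} (h : synth d n = some (r, m)) :
    SynthSound X M n m r := by
  induction d generalizing n m r with
  | var i _ => exact synthVar_spec X h
  | lam d ih =>
    obtain ⟨_, _, hr, h⟩ := Fresh.bind_eq_some.1 h
    obtain ⟨_, hs, ht⟩ := ih hr
    exact synthLam_spec hs ht h
  | app d e ihd ihe =>
    obtain ⟨_, _, hr₁, h⟩ := Fresh.bind_eq_some.1 h
    obtain ⟨_, _, hr₂, h⟩ := Fresh.bind_eq_some.1 h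
    obtain ⟨_, hs₁, ht₁⟩ := ihd hr₁
    obtain ⟨_, hs₂, ht₂⟩ := ihe hr₂
    exact synthApp_spec hs₁ ht₁ hs₂ ht₂ h

theorem contractBase_inst {B : List Entry} {xs : List ℕ} {B' : List (ℕ × GTy)} {A : List Constr}
    (h : contractBase B xs = some (B', A)) {X : ℕ → ℕ} (hA : IsSolution X A) {e : Entry}
    (he : e ∈ B) (hx : e.var ∈ xs) :
    instBase X B' e.var = some (e.ty.inst X) ∧ ∀ e' ∈ B, e'.var = e.var →
      e.ty.inst X = e'.ty.inst X ∧ (e ≠ e' → ∃ C, e.ty.inst X = .bang C) := by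
  induction xs generalizing B' A with
  | nil => exact absurd hx List.not_mem_nil
  | cons x xs ih =>
    simp only [contractBase, Option.bind_eq_bind, Option.bind_eq_some_iff, Option.some.injEq,
      Prod.mk.injEq, Prod.exists] at h
    obtain ⟨A₁, h₁, B₂, A₂, h₂, rfl, rfl⟩ := h
    obtain ⟨hA₁, hA₂⟩ := List.forall_mem_append.1 hA
    by_cases hvar : e.var = x
    · subst hvar
      refine ⟨?_, fun e' he' hvar' => contract_filter_inst h₁ hA₁ he rfl he' hvar'⟩
      have hmem : e ∈ B.filter fun e' => e'.var == e.var :=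
        List.mem_filter.2 ⟨he, beq_self_eq_true e.var⟩
      obtain ⟨e₀, es, hfilter⟩ := List.exists_cons_of_ne_nil (List.ne_nil_of_mem hmem)
      obtain ⟨he₀, hvar₀⟩ := List.mem_filter.1 (hfilter ▸ List.mem_cons_self)
      have hty := (contract_filter_inst h₁ hA₁ he rfl he₀ (beq_iff_eq.1 hvar₀)).1
      simp [instBase, hfilter, hty]
    · have hrest := ih h₂ hA₂ (List.mem_of_ne_of_mem hvar hx)
      refine ⟨?_, hrest.2⟩
      cases hfilter : B.filter fun e => e.var == x <;>
        simpa [instBase, hfilter, List.lookup, beq_false_of_ne hvar] using hrest.1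

theorem envFits_baseEnv (X : ℕ → ℕ) {B : List Entry} (hB : (fvo B).Nodup) :
    EnvFits X 0 0 B (baseEnv X B) := fun e he => by
  rw [baseEnv_occ X hB he]
  exact ⟨le_rfl, rfl⟩

theorem SynthTyped.of_isSolution {X : ℕ → ℕ} {r : Result} {J : ℕ → Env → Ty → Prop}
    (ht : SynthTyped X r J) (hB : (fvo r.base).Nodup)
    (hX : IsSolution X (r.rows.map Row.constr)) : J 0 (baseEnv X r.base) (r.ty.inst X) :=
  ht 0 (fun _ hsl => absurd hsl (Multiset.notMem_zero _)) (rowsSat_zero hX) 0 _ le_rfl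
    (envFits_baseEnv X hB)

theorem SynthShape.exists_candidate {M : Lam} {n m : ℕ} {r : Result} {D : Skel}
    (hs : SynthShape M n m r D) {X : ℕ → ℕ} {T : Ty} (hD : D.BoxTyped 0 (baseEnv X r.base) T)
    {Ξ : Ctx} (hΞ : ∀ e ∈ r.base, Ξ e.var = some (e.ty.inst X))
    (hshared : ∀ e ∈ r.base, ∀ e' ∈ r.base, e'.var = e.var →
      e.ty.inst X = e'.ty.inst X ∧ (e ≠ e' → ∃ C, e.ty.inst X = .bang C)) :
    ∃ P : EATerm, P.Candidate ∧ P.star = M ∧ NEAL Ξ P T := by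
  have hvar {e : Entry} (he : e ∈ r.base) := baseVar_occ hs.nodup he
  have henv {e : Entry} (he : e ∈ r.base) := baseEnv_occ X hs.nodup he
  obtain ⟨P, hP⟩ := hD.exists_realizes hs.linear (fun _ _ => rfl) (baseVar r.base)
    (fun y hy z hz hyz hρ => by
      obtain ⟨e, he, rfl⟩ := hs.exists_entry hy
      obtain ⟨e', he', rfl⟩ := hs.exists_entry hz
      rw [henv he, henv he']
      rw [hvar he, hvar he'] at hρ
      exact (hshared e he e' he' hρ.symm).imp_right fun h => h (ne_of_apply_ne _ hyz))
  refine ⟨P, hP.candidate, hP.star_eq.trans (hs.toLam_eq _ fun _ => hvar), hP.typed _ ?_⟩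
  intro y hy
  obtain ⟨e, he, rfl⟩ := hs.exists_entry hy
  rw [henv he, hvar he, hΞ e he]

end EAL

theorem mainTheorem5 {Γ : List EAL.STy} {M : EAL.Lam} {σ : EAL.STy} (d : EAL.SDer Γ M σ)
    (Θ : EAL.GTy) (B : List (ℕ × EAL.GTy)) (A : List EAL.Constr)
    (hS : EAL.typeSynthesis d = some (Θ, B, A))
    (X : ℕ → ℕ) (hX : EAL.IsSolution X A) :
    ∃ P : EAL.EATerm, P.Candidate ∧ P.star = M ∧
      EAL.NEAL (EAL.instBase X B) P (Θ.inst X) := by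
  simp only [EAL.typeSynthesis, Option.bind_eq_bind, Option.bind_eq_some_iff, Option.some.injEq,
    Prod.mk.injEq] at hS
  obtain ⟨⟨r, _⟩, hr, ⟨B', A'⟩, hB, rfl, rfl, rfl⟩ := hS
  obtain ⟨_, _, hsynth, hboxing⟩ := EAL.Fresh.bind_eq_some.1 hr
  obtain ⟨D, hs, ht⟩ := EAL.synth_spec X d hsynth
  obtain ⟨hs, ht⟩ := EAL.boxing_spec hs ht hboxing
  obtain ⟨hrows, hA'⟩ := List.forall_mem_append.1 hX
  have hbase (e) (he : e ∈ r.base) := EAL.contractBase_inst hB hA' he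
    (List.mem_dedup.2 (List.mem_map_of_mem he))
  exact hs.exists_candidate (ht.of_isSolution hs.nodup hrows) (fun e he => (hbase e he).1)
    fun e he => (hbase e he).2
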